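/- \textbf{Setting.} Let $\Gamma=(V,A)$ be a graph obtained from a finite connected graph $\Gamma_{\mathsf{int}}=(V_{\mathsf{int}},A_{\mathsf{int}})$ (its set of oriented edges being closed under $a=(o(a),t(a))\mapsto\overline a=(t(a),o(a))$) by attaching $N\ge 1$ half-lines (tails) with vertices $v_{j,0}\in V_{\mathsf{int}},v_{j,1},v_{j,2},\dots$, incoming edges $a^\flat_{j,k}=(v_{j,k+1},v_{j,k})$, $k\ge0$, and outgoing edges $a^\sharp_{j,l}=(v_{j,l-1},v_{j,l})$, $l\ge1$, for $j=1,\dots,N$; several tails may share the same vertex $v_{j,0}$. On $\mathcal H=\ell^2(A)$ with $\langle\psi,\phi\rangle=\sum_{a}\psi(a)\overline{\phi(a)}$ let $U=SC$, where $S\psi(a)=\psi(\overline a)$, $C\psi(a)=\sum_{t(b)=t(a)}c^{t(a)}_{a,b}\psi(b)$ and the matrix $c^v=[c^v_{a,b}]_{t(a)=t(b)=v}$ is unitary for every $v\in V$. Assume that $U$ is free on the tails: $U\psi(a^\flat_{j,k})=\psi(a^\flat_{j,k+1})$ and $U\psi(a^\sharp_{j,l+1})=\psi(a^\sharp_{j,l})$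 for $k\ge0$, $l\ge1$, $1\le j\le N$. For $\theta\in\mathbf C/2\pi\mathbf Z$ let $Q(\theta)$ be the operator on $\mathbf C^A$ that multiplies $\psi(a^\flat_{j,k})$ by $e^{i\theta k}$, $\psi(a^\sharp_{j,l})$ by $e^{-i\theta l}$, and $\psi(a)$, $a\in A_{\mathsf{int}}$, by $1$. The operator $U(\theta)=Q(\theta)UQ(\theta)^{-1}$ is bounded on $\mathcal H$. For $a\in\mathbf R$ put $\mathcal O_a^{\pm}=\{\kappa\in\mathbf C/2\pi\mathbf Z:\pm(\mathrm{Im}\,\kappa-a)>0\}$, put $\mathbf T=\mathbf R/2\pi\mathbf Z$, and let $\mathcal D$ be the space of all $\psi\in\mathbf C^A$ such that, for every $\tau>0$ and every $j$, $e^{\tau k}|\psi(a^\flat_{j,k})|\to0$ as $k\to\infty$ and $e^{\tau l}|\psi(a^\sharp_{j,l})|\to0$ as $l\to\infty$. \textbf{Lemma.} The space $\mathcal D$ is contained in $\mathcal H$ and dense in it. For $z\in\mathcal O_0^+$ the resolvent $R(z)=(U-e^{-iz})^{-1}$ exists in $\mathbf B(\mathcal H)$; put $F_\phi(z)=\langle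 R(z)\phi,\phi\rangle$ for $\phi\in\mathcal D$. (1) For every $a<0$ and every $\phi\in\mathcal D$, the function $F_\phi$ has a meromorphic extension from $\mathcal O_0^+$ to $\mathcal O_a^+$. Its poles have finite rank: for every $z_0\in\mathcal O_a^+$ there are finitely many sesquilinear forms $B_1,\dots,B_M$ of finite rank on $\mathcal D$, independent of $\phi$, such that $F_\phi(z)-\sum_{m=1}^M B_m(\phi,\phi)(z-z_0)^{-m}$ is analytic near $z_0$ for all $\phi\in\mathcal D$. (2) All poles of $F_\phi$ in $\mathcal O_a^+$ lie on $\mathbf T$ or in $\mathcal O_0^-\cap\mathcal O_a^+$. (3) For every $\theta\in\mathcal O_0^-$ and every $z\in\mathcal O_a^+\cap\mathcal O_{\mathrm{Im}\,\theta}^+$, the point $z$ is a pole of $F_\phi$ for some $\phi\in\mathcal D$ if and only if $e^{-iz}$ is an eigenvalue of $U(\theta)$. (4) These eigenvalues do not depend on $\theta$: if $\theta,\theta'\in\mathcal O_0^-$ and $z\in\mathcal O_{\mathrm{Im}\,\theta}^+\cap\mathcal O_{\mathrm{Im}\,\theta'}^+$, then $e^{-iz}$ is an eigenvalue of $U(\theta)$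 if and only if it is an eigenvalue of $U(\theta')$. -/

import Mathlib

open Filter Topology
open scoped ENNReal Classical

/-- A finite connected (symmetric) directed graph on the vertex set `V` (the internal graph),
together with `N` half-lines ("tails"), the `j`-th of which is attached at the vertex `base j`.
Loops are allowed, and several tails may share the same base vertex. -/
structure TailGraph (V : Type*) (N : ℕ) where
  /-- `Adj u v` says that `(u, v)` is an internal oriented edge. -/
  Adj : V → V → Prop
  symm : ∀ u v, Adj u v → Adj v u
  connected : ∀ u v, Relation.ReflTransGen Adj u v
  base : Fin N → V

namespace TailGraph

variable {V : Type*} {N : ℕ}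

/-- Vertices of the whole graph: internal ones, and `Sum.inr (j, k)`, which is `v_{j, k+1}`. -/
abbrev Vertex (_ : TailGraph V N) : Type _ := V ⊕ (Fin N × ℕ)

/-- The vertex `v_{j, k}` of the `j`-th tail; `v_{j, 0}` is internal. -/
def vert (Γ : TailGraph V N) (j : Fin N) : ℕ → Γ.Vertex
  | 0 => Sum.inl (Γ.base j)
  | k + 1 => Sum.inr (j, k)

/-- The oriented edges: the internal edges `(u, v)`, the incoming edges
`flat j k = (v_{j, k+1}, v_{j, k})`, `k ≥ 0`, and the outgoing edges
`sharp j k = (v_{j, k}, v_{j, k+1})`, `k ≥ 0`.  In the usual indexing, in which outgoing edges are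
numbered from `1`, the edge `sharp j k` is `a_{j, k+1}^♯`. -/
inductive Arc (Γ : TailGraph V N) : Type _
  | int (u v : V) (h : Γ.Adj u v)
  | flat (j : Fin N) (k : ℕ)
  | sharp (j : Fin N) (k : ℕ)

variable {Γ : TailGraph V N}

namespace Arc

/-- The origin of an oriented edge. -/
def org : Γ.Arc → Γ.Vertex
  | int u _ _ => Sum.inl u
  | flat j k => Γ.vert j (k + 1)
  | sharp j k => Γ.vert j k

/-- The terminal vertex of an oriented edge. -/
def ter : Γ.Arc → Γ.Vertex
  | int _ v _ => Sum.inl v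
  | flat j k => Γ.vert j k
  | sharp j k => Γ.vert j (k + 1)

/-- The reversed edge. -/
def rev : Γ.Arc → Γ.Arc
  | int u v h => int v u (Γ.symm u v h)
  | flat j k => sharp j k
  | sharp j k => flat j k

theorem rev_rev (a : Γ.Arc) : a.rev.rev = a := by cases a <;> rfl

/-- The position of an edge on its tail, seen as a copy of `ℤ`: `a_{j, k}^♭ ↦ k` and
`a_{j, l}^♯ ↦ -l`.  Internal edges get the value `0`. -/
def pos : Γ.Arc → ℤ
  | int _ _ _ => 0
  | flat _ k => k
  | sharp _ k => -((k : ℤ) + 1)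

end Arc

/-- The edges that terminate at the vertex `v`. -/
abbrev InArc (Γ : TailGraph V N) (v : Γ.Vertex) : Type _ := {a : Γ.Arc // a.ter = v}

instance finite_inArc [Finite V] (v : Γ.Vertex) : Finite (Γ.InArc v) := by
  have hint : Set.Finite {a : Γ.Arc | ∃ u w h, a = Arc.int u w h} := by
    let f : {p : V × V // Γ.Adj p.1 p.2} → Γ.Arc := fun p => Arc.int p.1.1 p.1.2 p.2
    refine (Set.finite_range f).subset ?_
    rintro a ⟨u, w, h, rfl⟩
    exact ⟨⟨(u, w), h⟩, rfl⟩
  have hbd : ∀ m : ℕ, Set.Finite {a : Γ.Arc | ∃ j, a = Arc.flat j m ∨ a = Arc.sharp j m} := by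
    intro m
    refine ((Set.finite_range fun j : Fin N => (Arc.flat j m : Γ.Arc)).union
      (Set.finite_range fun j : Fin N => (Arc.sharp j m : Γ.Arc))).subset ?_
    rintro a ⟨j, rfl | rfl⟩
    · exact Or.inl ⟨j, rfl⟩
    · exact Or.inr ⟨j, rfl⟩
  have key : Set.Finite {a : Γ.Arc | a.ter = v} := by
    cases v with
    | inl x =>
      refine (hint.union (hbd 0)).subset ?_
      intro a ha
      rcases a with ⟨u, w, h⟩ | ⟨j, k⟩ | ⟨j, k⟩
      · exact Or.inl ⟨u, w, h, rfl⟩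
      · cases k with
        | zero => exact Or.inr ⟨j, Or.inl rfl⟩
        | succ k => simp [Arc.ter, vert] at ha
      · simp [Arc.ter, vert] at ha
    | inr p =>
      refine ((hbd (p.2 + 1)).union (hbd p.2)).subset ?_
      intro a ha
      rcases a with ⟨u, w, h⟩ | ⟨j, k⟩ | ⟨j, k⟩
      · simp [Arc.ter] at ha
      · cases k with
        | zero => simp [Arc.ter, vert] at ha
        | succ k =>
          simp only [Arc.ter, vert, Set.mem_ofPred_eq, Sum.inr.injEq] at ha
          subst ha
          exact Or.inl ⟨j, Or.inl rfl⟩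
      · simp only [Arc.ter, vert, Set.mem_ofPred_eq, Sum.inr.injEq] at ha
        subst ha
        exact Or.inr ⟨j, Or.inr rfl⟩
  exact key

noncomputable instance fintype_inArc [Finite V] (v : Γ.Vertex) : Fintype (Γ.InArc v) :=
  Fintype.ofFinite _

/-- The Hilbert space `ℓ²(A)`. -/
abbrev H (Γ : TailGraph V N) : Type _ := lp (fun _ : Γ.Arc => ℂ) 2

/-- The shift operator `S ψ (a) = ψ (ā)` on `ℂ^A`. -/
def shift (Γ : TailGraph V N) : (Γ.Arc → ℂ) →ₗ[ℂ] (Γ.Arc → ℂ) where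
  toFun ψ a := ψ a.rev
  map_add' _ _ := rfl
  map_smul' _ _ := rfl

/-- The coin operator `C ψ (a) = ∑_{b : t(b) = t(a)} c^{t(a)}_{a, b} ψ (b)` on `ℂ^A`. -/
noncomputable def coinOp [Finite V] (c : ∀ v : Γ.Vertex, Matrix (Γ.InArc v) (Γ.InArc v) ℂ) :
    (Γ.Arc → ℂ) →ₗ[ℂ] (Γ.Arc → ℂ) where
  toFun ψ a := ∑ b : Γ.InArc a.ter, c a.ter ⟨a, rfl⟩ b * ψ b
  map_add' ψ φ := by
    funext a
    simp [mul_add, Finset.sum_add_distrib]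
  map_smul' z ψ := by
    funext a
    simp only [Pi.smul_apply, smul_eq_mul, RingHom.id_apply, Finset.mul_sum]
    exact Finset.sum_congr rfl fun b _ => by ring

/-- A quantum walk on `Γ`: a unitary coin matrix at every vertex, such that the time evolution
`S C` is the free walk along every tail. -/
structure QuantumWalk [Finite V] (Γ : TailGraph V N) where
  coin : ∀ v : Γ.Vertex, Matrix (Γ.InArc v) (Γ.InArc v) ℂ
  coin_unitary : ∀ v, coin v ∈ Matrix.unitaryGroup (Γ.InArc v) ℂ
  free_flat : ∀ (ψ : Γ.Arc → ℂ) (j : Fin N) (k : ℕ),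
    Γ.shift (coinOp coin ψ) (Arc.flat j k) = ψ (Arc.flat j (k + 1))
  free_sharp : ∀ (ψ : Γ.Arc → ℂ) (j : Fin N) (k : ℕ),
    Γ.shift (coinOp coin ψ) (Arc.sharp j (k + 1)) = ψ (Arc.sharp j k)

/-- The distortion `Q(θ)` on `ℂ^A`: multiplication by `e^{iθx}` on every tail `≅ ℤ`, and the
identity on the internal edges.  Its inverse is `Q(-θ)`. -/
noncomputable def distortion (Γ : TailGraph V N) (θ : ℂ) : (Γ.Arc → ℂ) →ₗ[ℂ] (Γ.Arc → ℂ) where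
  toFun ψ a := Complex.exp (Complex.I * θ * a.pos) * ψ a
  map_add' ψ φ := by
    funext a
    simp [mul_add]
  map_smul' z ψ := by
    funext a
    simp only [Pi.smul_apply, smul_eq_mul, RingHom.id_apply]
    ring

theorem distortion_comp_neg (θ : ℂ) (ψ : Γ.Arc → ℂ) :
    Γ.distortion θ (Γ.distortion (-θ) ψ) = ψ := by
  funext a
  change Complex.exp _ * (Complex.exp _ * ψ a) = ψ a
  rw [← mul_assoc, ← Complex.exp_add]
  simp

/-- `e^{τk} ψ(a_{j,k}^♭) → 0` and `e^{τl} ψ(a_{j,l}^♯) → 0` for every rate `τ > 0`. -/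
def RapidDecay (ψ : Γ.Arc → ℂ) : Prop :=
  ∀ γ : ℝ, 0 < γ → ∀ τ ∈ Set.Ioo 0 γ, ∀ j : Fin N,
    Tendsto (fun k : ℕ => Real.exp (τ * k) * ‖ψ (Arc.flat j k)‖) atTop (𝓝 0) ∧
    Tendsto (fun k : ℕ => Real.exp (τ * (k + 1)) * ‖ψ (Arc.sharp j k)‖) atTop (𝓝 0)

/-- The space `𝒟` of the super-exponentially decaying states, as a subspace of `ℓ²(A)`. -/
def decaySpace (Γ : TailGraph V N) : Submodule ℂ Γ.H where
  carrier := {x | RapidDecay (x : Γ.Arc → ℂ)}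
  zero_mem' := by
    intro γ _ τ _ j
    simp
  add_mem' := by
    intro x y hx hy γ hγ τ hτ j
    obtain ⟨hx1, hx2⟩ := hx γ hγ τ hτ j
    obtain ⟨hy1, hy2⟩ := hy γ hγ τ hτ j
    constructor
    · refine squeeze_zero (fun k => by positivity) (fun k => ?_) (by simpa using hx1.add hy1)
      rw [← mul_add]
      exact mul_le_mul_of_nonneg_left (norm_add_le _ _) (Real.exp_pos _).le
    · refine squeeze_zero (fun k => by positivity) (fun k => ?_) (by simpa using hx2.add hy2)
      rw [← mul_add]
      exact mul_le_mul_of_nonneg_left (norm_add_le _ _) (Real.exp_pos _).le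
  smul_mem' := by
    intro c x hx γ hγ τ hτ j
    obtain ⟨hx1, hx2⟩ := hx γ hγ τ hτ j
    have e : ∀ (r s : ℝ), r * (‖c‖ * s) = ‖c‖ * (r * s) := fun r s => by ring
    constructor
    · simpa [e] using hx1.const_mul ‖c‖
    · simpa [e] using hx2.const_mul ‖c‖

theorem hasSum_sq (x : Γ.H) : HasSum (fun a => ‖x a‖ ^ 2) (‖x‖ ^ 2) := by
  have h := lp.hasSum_norm (p := 2) (by norm_num) x
  simpa using h

theorem pos_inArc (x : V) (b : Γ.InArc (Sum.inl x)) : b.1.pos = 0 := by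
  obtain ⟨b, hb⟩ := b
  rcases b with ⟨u, w, h⟩ | ⟨j, k⟩ | ⟨j, k⟩
  · rfl
  · cases k with
    | zero => rfl
    | succ k => simp [Arc.ter, vert] at hb
  · simp [Arc.ter, vert] at hb

namespace QuantumWalk

variable [Finite V] (W : QuantumWalk Γ)

/-- The time evolution `U = S C` on `ℂ^A`. -/
noncomputable def evol : (Γ.Arc → ℂ) →ₗ[ℂ] (Γ.Arc → ℂ) := Γ.shift ∘ₗ coinOp W.coin

/-- The distorted evolution `Q(θ) U Q(θ)⁻¹` on `ℂ^A`. -/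
noncomputable def distortedEvol (θ : ℂ) : (Γ.Arc → ℂ) →ₗ[ℂ] (Γ.Arc → ℂ) :=
  Γ.distortion θ ∘ₗ W.evol ∘ₗ Γ.distortion (-θ)

theorem sum_coin (ψ : Γ.Arc → ℂ) (v : Γ.Vertex) :
    ∑ a : Γ.InArc v, ‖coinOp W.coin ψ a‖ ^ 2 = ∑ a : Γ.InArc v, ‖ψ a‖ ^ 2 := by
  set x : Γ.InArc v → ℂ := fun b => ψ b with hx
  have h1 : ∀ a : Γ.InArc v, coinOp W.coin ψ a = (W.coin v).mulVec x a := by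
    rintro ⟨a, rfl⟩
    rfl
  have h2 : ∀ y : Γ.InArc v → ℂ, ((∑ a, ‖y a‖ ^ 2 : ℝ) : ℂ) = star y ⬝ᵥ y := by
    intro y
    simp only [dotProduct, Pi.star_apply, RCLike.star_def, Complex.conj_mul']
    push_cast
    rfl
  have h3 : star ((W.coin v).mulVec x) ⬝ᵥ (W.coin v).mulVec x = star x ⬝ᵥ x := by
    rw [Matrix.star_mulVec, Matrix.dotProduct_mulVec, Matrix.vecMul_vecMul,
      ← Matrix.star_eq_conjTranspose, Matrix.mem_unitaryGroup_iff'.1 (W.coin_unitary v),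
      Matrix.vecMul_one]
  have h4 := h2 ((W.coin v).mulVec x)
  rw [h3, ← h2 x] at h4
  simp only [h1]
  exact_mod_cast h4

theorem evol_hasSum (ψ : Γ.Arc → ℂ) {s : ℝ} (h : HasSum (fun a => ‖ψ a‖ ^ 2) s) :
    HasSum (fun a => ‖W.evol ψ a‖ ^ 2) s := by
  let e : (Σ v : Γ.Vertex, Γ.InArc v) ≃ Γ.Arc := Equiv.sigmaFiberEquiv Arc.ter
  have h1 : HasSum (fun p : (Σ v : Γ.Vertex, Γ.InArc v) => ‖ψ p.2‖ ^ 2) s :=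
    (e.hasSum_iff (f := fun a => ‖ψ a‖ ^ 2)).2 h
  have h2 : HasSum (fun v : Γ.Vertex => ∑ a : Γ.InArc v, ‖ψ a‖ ^ 2) s :=
    h1.sigma fun v => hasSum_fintype _
  have h3 : HasSum (fun p : (Σ v : Γ.Vertex, Γ.InArc v) => ‖coinOp W.coin ψ p.2‖ ^ 2) s := by
    refine HasSum.sigma_of_hasSum (g := fun v => ∑ a : Γ.InArc v, ‖coinOp W.coin ψ a‖ ^ 2)
      (by simpa only [W.sum_coin] using h2) (fun v => hasSum_fintype _) ?_
    refine (summable_sigma_of_nonneg fun _ => by positivity).2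
      ⟨fun v => (hasSum_fintype _).summable, ?_⟩
    simpa only [tsum_fintype, W.sum_coin] using h2.summable
  have h4 : HasSum (fun a => ‖coinOp W.coin ψ a‖ ^ 2) s :=
    (e.hasSum_iff (f := fun a => ‖coinOp W.coin ψ a‖ ^ 2)).1 h3
  let r : Γ.Arc ≃ Γ.Arc := ⟨Arc.rev, Arc.rev, Arc.rev_rev, Arc.rev_rev⟩
  exact (r.hasSum_iff (f := fun a => ‖coinOp W.coin ψ a‖ ^ 2)).2 h4

theorem evol_memℓp (x : Γ.H) : Memℓp (W.evol x) 2 := by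
  refine memℓp_gen ?_
  simpa using (W.evol_hasSum x (hasSum_sq x)).summable

/-- The time evolution `U` as a bounded operator on `ℓ²(A)`. -/
noncomputable def U : Γ.H →L[ℂ] Γ.H :=
  LinearMap.mkContinuous
    { toFun := fun x => ⟨W.evol x, W.evol_memℓp x⟩
      map_add' := fun x y => by
        ext a
        exact congrFun (map_add _ (x : Γ.Arc → ℂ) y) a
      map_smul' := fun c x => by
        ext a
        exact congrFun (map_smul _ c (x : Γ.Arc → ℂ)) a } 1 (fun x => by
    have h := (hasSum_sq (Γ := Γ) ⟨W.evol x, W.evol_memℓp x⟩).unique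
      (W.evol_hasSum x (hasSum_sq x))
    rw [one_mul]
    exact (pow_le_pow_iff_left₀ (norm_nonneg _) (norm_nonneg _) two_ne_zero).1 h.le)

theorem U_apply (x : Γ.H) (a : Γ.Arc) : W.U x a = W.evol x a := rfl

theorem norm_U_le (x : Γ.H) : ‖W.U x‖ ≤ ‖x‖ := by
  have h := (hasSum_sq (Γ := Γ) (W.U x)).unique (W.evol_hasSum x (hasSum_sq x))
  exact (pow_le_pow_iff_left₀ (norm_nonneg _) (norm_nonneg _) two_ne_zero).1 h.le

theorem evol_distortion_of_inl (θ : ℂ) (ψ : Γ.Arc → ℂ) (a : Γ.Arc) (x : V)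
    (ha : a.rev.ter = Sum.inl x) : W.evol (Γ.distortion θ ψ) a = W.evol ψ a := by
  change (∑ b : Γ.InArc a.rev.ter, W.coin a.rev.ter ⟨a.rev, rfl⟩ b *
    (Complex.exp (Complex.I * θ * (b.1.pos : ℤ)) * ψ b)) =
    ∑ b : Γ.InArc a.rev.ter, W.coin a.rev.ter ⟨a.rev, rfl⟩ b * ψ b
  refine Finset.sum_congr rfl fun b _ => ?_
  have hb : b.1.pos = 0 := pos_inArc x ⟨b.1, b.2.trans ha⟩
  simp [hb]

/-- `U(θ)` multiplies `U` by `e^{-iθ}` on the tails and by `1` on the internal edges. -/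
theorem distortedEvol_apply (θ : ℂ) (ψ : Γ.Arc → ℂ) (a : Γ.Arc) :
    W.distortedEvol θ ψ a =
      (match a with
        | Arc.int _ _ _ => 1
        | Arc.flat _ _ => Complex.exp (-(Complex.I * θ))
        | Arc.sharp _ _ => Complex.exp (-(Complex.I * θ))) * W.evol ψ a := by
  change Complex.exp (Complex.I * θ * (a.pos : ℤ)) * W.evol (Γ.distortion (-θ) ψ) a = _
  rcases a with ⟨u, w, h⟩ | ⟨j, k⟩ | ⟨j, k⟩
  · rw [W.evol_distortion_of_inl (-θ) ψ (Arc.int u w h) u rfl]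
    simp [Arc.pos]
  · have h : ∀ φ : Γ.Arc → ℂ, W.evol φ (Arc.flat j k) = φ (Arc.flat j (k + 1)) :=
      fun φ => W.free_flat φ j k
    rw [h, h]
    change _ * (Complex.exp _ * _) = _
    rw [← mul_assoc, ← Complex.exp_add]
    congr 2
    simp only [Arc.pos]
    push_cast
    ring
  · cases k with
    | zero =>
      rw [W.evol_distortion_of_inl (-θ) ψ (Arc.sharp j 0) (Γ.base j) rfl]
      simp [Arc.pos]
    | succ k =>
      have h : ∀ φ : Γ.Arc → ℂ, W.evol φ (Arc.sharp j (k + 1)) = φ (Arc.sharp j k) :=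
        fun φ => W.free_sharp φ j k
      rw [h, h]
      change _ * (Complex.exp _ * _) = _
      rw [← mul_assoc, ← Complex.exp_add]
      congr 2
      simp only [Arc.pos]
      push_cast
      ring

theorem norm_distortedEvol_le (θ : ℂ) (ψ : Γ.Arc → ℂ) (a : Γ.Arc) :
    ‖W.distortedEvol θ ψ a‖ ≤
      ‖((max 1 ‖Complex.exp (-(Complex.I * θ))‖ : ℝ) : ℂ) * W.evol ψ a‖ := by
  rw [W.distortedEvol_apply, norm_mul, norm_mul, Complex.norm_real, Real.norm_of_nonneg
    (zero_le_one.trans (le_max_left _ _))]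
  refine mul_le_mul_of_nonneg_right ?_ (norm_nonneg _)
  rcases a with ⟨u, w, h⟩ | ⟨j, k⟩ | ⟨j, k⟩
  · simp
  · exact le_max_right _ _
  · exact le_max_right _ _

theorem distortedEvol_memℓp (θ : ℂ) (x : Γ.H) : Memℓp (W.distortedEvol θ x) 2 :=
  ((W.evol_memℓp x).const_mul _).mono' (W.norm_distortedEvol_le θ x)

/-- The distorted evolution `U(θ) = Q(θ) U Q(θ)⁻¹` as a bounded operator on `ℓ²(A)`, for every
complex `θ`. -/
noncomputable def distortedU (θ : ℂ) : Γ.H →L[ℂ] Γ.H :=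
  LinearMap.mkContinuous
    { toFun := fun x => ⟨W.distortedEvol θ x, W.distortedEvol_memℓp θ x⟩
      map_add' := fun x y => by
        ext a
        exact congrFun (map_add _ (x : Γ.Arc → ℂ) y) a
      map_smul' := fun c x => by
        ext a
        exact congrFun (map_smul _ c (x : Γ.Arc → ℂ)) a } (max 1 ‖Complex.exp (-(Complex.I * θ))‖) (fun x => by
    have h := lp.norm_mono two_ne_zero
      (x := (⟨W.distortedEvol θ x, W.distortedEvol_memℓp θ x⟩ : Γ.H))
      (y := ((max 1 ‖Complex.exp (-(Complex.I * θ))‖ : ℝ) : ℂ) • W.U x)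
      (W.norm_distortedEvol_le θ x)
    refine h.trans ?_
    rw [norm_smul, Complex.norm_real, Real.norm_of_nonneg (zero_le_one.trans (le_max_left _ _))]
    refine mul_le_mul_of_nonneg_left ?_ (zero_le_one.trans (le_max_left _ _))
    simpa using W.norm_U_le x)

/-- The resolvent `R(z) = (U - e^{-iz})⁻¹`. -/
noncomputable def R (z : ℂ) : Γ.H →L[ℂ] Γ.H :=
  Ring.inverse (W.U - Complex.exp (-(Complex.I * z)) • (1 : Γ.H →L[ℂ] Γ.H))

/-- `F_φ(z) = ⟨R(z) φ, φ⟩`, where `⟨ψ, φ⟩ = ∑ ψ(a) conj (φ(a))`. -/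
noncomputable def F (φ : Γ.decaySpace) (z : ℂ) : ℂ := inner ℂ (φ : Γ.H) (W.R z φ)

/-- `μ` is an eigenvalue of `U(θ)`, with an eigenvector in `ℓ²(A)`. -/
def IsDistortedEigenvalue (θ μ : ℂ) : Prop :=
  Module.End.HasEigenvalue (W.distortedU θ : Γ.H →ₗ[ℂ] Γ.H) μ

/-- `G` is a meromorphic extension of `F_φ` from `{Im z > 0}` to `{Im z > a}`, where both half
planes are taken modulo `2πℤ`. -/
structure IsMeromorphicExtension (a : ℝ) (φ : Γ.decaySpace) (G : ℂ → ℂ) : Prop where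
  periodic : ∀ z, G (z + 2 * Real.pi) = G z
  eqOn : ∀ z, 0 < z.im → G z = W.F φ z
  meromorphicOn : MeromorphicOn G {z | a < z.im}

end QuantumWalk

/-- `z` is a pole of `G`. -/
def IsPole (G : ℂ → ℂ) (z : ℂ) : Prop := MeromorphicAt G z ∧ meromorphicOrderAt G z < 0

/-- The family of functions `G_φ`, `φ ∈ 𝒟`, has at `z₀` at most a pole of finite rank:
for some sesquilinear forms `B_0, …, B_{M-1}` of finite rank on `𝒟`, the principal part of every
`G_φ` at `z₀` is `∑ B_m(φ, φ) (z - z₀)^{-(m+1)}`. -/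
def HasFiniteRankPoleAt (G : Γ.decaySpace → ℂ → ℂ) (z₀ : ℂ) : Prop :=
  ∃ (M : ℕ) (B : Fin M → Γ.decaySpace →ₗ⋆[ℂ] Γ.decaySpace →ₗ[ℂ] ℂ),
    (∀ m, FiniteDimensional ℂ (LinearMap.range (B m))) ∧
    ∀ φ, ∃ h : ℂ → ℂ, AnalyticAt ℂ h z₀ ∧
      ∀ᶠ z in 𝓝[≠] z₀, G φ z = ∑ m, B m φ φ * ((z - z₀) ^ ((m : ℕ) + 1))⁻¹ + h z

end TailGraph

/-!
Off the finite internal graph the walk is a shift, so the equation `(U - e^{-iz}) ψ = φ` can be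
solved explicitly along the tails. With `w = e^{iz}`, an incoming tail carries
`ψ(a_{j,k}^♭) = -∑_m w^{m+1} φ(a_{j,k+m}^♭)`, and an outgoing tail carries the geometric
continuation of what leaves the internal graph together with a convolution of `φ` with the powers
of `w`. For rapidly decaying `φ` all these series are entire in `w`
(`RapidSeq.differentiable_tsum`).
What remains on the internal edges is a finite linear system whose matrix is `K - e^{-iz}`, where
`K` is the compression of `U` to the internal edges (`QuantumWalk.pencil`). Hence
`⟨R(z) φ, φ⟩` equals an entire function plus
`∑_{a,b} α_a(φ, z) [(K - e^{-iz})⁻¹]_{a,b} β_b(φ, z)`, where `α_a` is antilinear and `β_b` linear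
in `φ`, and both are entire in `z` (`QuantumWalk.extF_eq_F`). This formula defines the
extension `QuantumWalk.extF` on the whole plane, so it serves every half plane `Im z > a` at once.

Cramer's rule bounds the order of the poles by that of the zero of `det (K - e^{-iz})`, and
expanding `α_a` and `β_b` in powers of `z - z₀` shows that the principal parts have finite rank
(`hasFiniteRankPoleAt_mul`). Poles occur exactly at the zeros of the determinant: an eigenvector
`v` of `K` with eigenvalue `e^{-iz₀}`, taken as `φ`, gives `‖v‖² / (e^{-iz₀} - e^{-iz})`
(`QuantumWalk.exists_isPole_extF`). Since `K` is a contraction, none lies in the upper half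
plane (`QuantumWalk.det_pencil_ne_zero`).

Finally, if `Im θ < Im z`, then an `ℓ²` eigenvector of `U(θ)` with eigenvalue `e^{-iz}` must vanish
on the incoming tails, and is determined on the outgoing ones, where it decays geometrically, by
its internal part. So these eigenvalues are exactly those of `K`, which does not involve `θ`
(`QuantumWalk.isDistortedEigenvalue_iff_det`).
-/

/-! ### Rapidly decaying sequences and entire functions -/

/-- A sequence decays rapidly if it is bounded by every geometric sequence. -/
def RapidSeq (f : ℕ → ℂ) : Prop := ∀ r : ℝ, 0 < r → ∃ C : ℝ, ∀ k, ‖f k‖ * r ^ k ≤ C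

namespace RapidSeq

variable {f : ℕ → ℂ}

theorem conj (hf : RapidSeq f) : RapidSeq fun k => starRingEnd ℂ (f k) := by
  intro r hr
  simpa using hf r hr

theorem shift (hf : RapidSeq f) (k : ℕ) : RapidSeq fun m => f (k + m) := by
  intro r hr
  obtain ⟨C, hC⟩ := hf r hr
  refine ⟨C / r ^ k, fun m => ?_⟩
  rw [le_div_iff₀ (pow_pos hr k), mul_assoc, ← pow_add, add_comm m k]
  exact hC _

/-- Multiplication by a rapidly decaying sequence turns geometric growth into geometric decay. -/
theorem norm_mul_le (hf : RapidSeq f) (C : ℝ) {q : ℝ} (hq : 0 < q) :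
    ∃ D : ℝ, ∀ (k : ℕ) (y : ℂ), ‖y‖ ≤ C * q ^ k → ‖f k * y‖ ≤ D * (1 / 2) ^ k := by
  -- The rate `2 * q` beats the growth rate `q` by the ratio `1 / 2` of a summable series.
  obtain ⟨B, hB⟩ := hf (2 * q) (by positivity)
  refine ⟨B * C, fun k y hy => ?_⟩
  have hC : 0 ≤ C := by
    have := (norm_nonneg y).trans hy
    exact nonneg_of_mul_nonneg_left this (pow_pos hq k)
  calc ‖f k * y‖ ≤ ‖f k‖ * (C * q ^ k) := by
        rw [norm_mul]; exact mul_le_mul_of_nonneg_left hy (norm_nonneg _)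
    _ = ‖f k‖ * (2 * q) ^ k * (C * (1 / 2) ^ k) := by
        rw [mul_pow, one_div, inv_pow]; field_simp
    _ ≤ B * (C * (1 / 2) ^ k) := mul_le_mul_of_nonneg_right (hB k) (by positivity)
    _ = B * C * (1 / 2) ^ k := by ring

theorem summable_mul (hf : RapidSeq f) {g : ℕ → ℂ} {C q : ℝ} (hq : 0 < q)
    (hg : ∀ k, ‖g k‖ ≤ C * q ^ k) : Summable fun k => f k * g k := by
  obtain ⟨D, hD⟩ := hf.norm_mul_le C hq
  exact Summable.of_norm_bounded ((summable_geometric_of_lt_one (by norm_num)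
    (by norm_num)).mul_left D) fun k => hD k _ (hg k)

theorem summable_mul_pow (hf : RapidSeq f) (w : ℂ) : Summable fun k => f k * w ^ (k + 1) := by
  refine hf.summable_mul (C := max 1 ‖w‖) (q := max 1 ‖w‖) (by positivity) fun k => ?_
  rw [norm_pow, pow_succ']
  have : ‖w‖ ≤ max 1 ‖w‖ := le_max_right _ _
  gcongr

/-- A series of entire functions that grow at most geometrically, uniformly on discs, becomes
locally uniformly convergent when weighted by a rapidly decaying sequence. -/
theorem differentiable_tsum (hf : RapidSeq f) {g : ℕ → ℂ → ℂ} (hg : ∀ k, Differentiable ℂ (g k))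
    (hb : ∀ R : ℝ, 1 ≤ R → ∃ C q : ℝ, 0 < q ∧ ∀ k w, ‖w‖ < R → ‖g k w‖ ≤ C * q ^ k) :
    Differentiable ℂ fun w => ∑' k, f k * g k w := by
  intro w
  obtain ⟨C, q, hq, hC⟩ := hb (‖w‖ + 1) (by linarith [norm_nonneg w])
  obtain ⟨D, hD⟩ := hf.norm_mul_le C hq
  have := Complex.differentiableOn_tsum_of_summable_norm (U := Metric.ball (0 : ℂ) (‖w‖ + 1))
    (F := fun k w => f k * g k w)
    ((summable_geometric_of_lt_one (by norm_num : (0 : ℝ) ≤ 1 / 2) (by norm_num)).mul_left D)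
    (fun k => ((hg k).const_mul (f k)).differentiableOn) Metric.isOpen_ball
    (fun k z hz => hD k _ (hC k z (by simpa using hz)))
  exact this.differentiableAt (Metric.isOpen_ball.mem_nhds (by simp))

theorem differentiable_tsum_mul_pow (hf : RapidSeq f) :
    Differentiable ℂ fun w => ∑' k, f k * w ^ (k + 1) := by
  refine hf.differentiable_tsum (fun k => differentiable_pow (k + 1)) fun R hR =>
    ⟨R, R, by linarith, fun k w hw => ?_⟩
  rw [norm_pow, ← pow_succ']
  gcongr

/-- The solution of a free recursion on an incoming tail: the value at `k` collects the sources
situated at `k`, `k + 1`, … -/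
noncomputable def tailSeries (f : ℕ → ℂ) (k : ℕ) (w : ℂ) : ℂ := ∑' m, f (k + m) * w ^ (m + 1)

/-- The solution of a free recursion on an outgoing tail: the value at `k` collects the sources
situated at `0`, …, `k`. -/
noncomputable def convSeries (f : ℕ → ℂ) (k : ℕ) (w : ℂ) : ℂ :=
  ∑ m ∈ Finset.range (k + 1), f (k - m) * w ^ (m + 1)

theorem tailSeries_bound (hf : RapidSeq f) {R : ℝ} (hR : 1 ≤ R) :
    ∃ C q : ℝ, 0 < q ∧ ∀ k w, ‖w‖ < R → ‖tailSeries f k w‖ ≤ C * q ^ k := by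
  obtain ⟨C, hC⟩ := hf (2 * R) (by linarith)
  have hC0 : 0 ≤ C := le_trans (by positivity) (hC 0)
  refine ⟨C * R * 2, 1, one_pos, fun k w hw => ?_⟩
  rw [one_pow, mul_one]
  refine tsum_of_norm_bounded (g := fun m => C * R * (1 / 2) ^ m)
    (hasSum_geometric_two.mul_left (C * R)) fun m => ?_
  have hR0 : 0 < R := by linarith
  calc ‖f (k + m) * w ^ (m + 1)‖ ≤ ‖f (k + m)‖ * R ^ (m + 1) := by
        rw [norm_mul, norm_pow]; gcongr
    _ ≤ (‖f (k + m)‖ * (2 * R) ^ k) * R ^ (m + 1) := by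
        have : 1 ≤ (2 * R) ^ k := one_le_pow₀ (by linarith)
        gcongr
        exact le_mul_of_one_le_right (norm_nonneg _) this
    _ = ‖f (k + m)‖ * (2 * R) ^ (k + m) * (R * (1 / 2) ^ m) := by
        rw [pow_add (2 * R), mul_pow 2 R m, pow_succ, one_div, inv_pow]; field_simp
    _ ≤ C * (R * (1 / 2) ^ m) := mul_le_mul_of_nonneg_right (hC _) (by positivity)
    _ = C * R * (1 / 2) ^ m := by ring

/-- On a disc the convolution grows at most geometrically: it has `k + 1 ≤ 2 ^ k` terms. -/
theorem convSeries_bound (hf : RapidSeq f) {R : ℝ} (hR : 1 ≤ R) :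
    ∃ C q : ℝ, 0 < q ∧ ∀ k w, ‖w‖ < R → ‖convSeries f k w‖ ≤ C * q ^ k := by
  obtain ⟨C, hC⟩ := hf 1 one_pos
  simp only [one_pow, mul_one] at hC
  have hC0 : 0 ≤ C := (norm_nonneg _).trans (hC 0)
  refine ⟨C * R, 2 * R, by linarith, fun k w hw => ?_⟩
  have h1 : ∀ m ∈ Finset.range (k + 1), ‖f (k - m) * w ^ (m + 1)‖ ≤ C * R ^ (k + 1) := by
    intro m hm
    rw [norm_mul, norm_pow]
    have h2 : ‖w‖ ^ (m + 1) ≤ R ^ (m + 1) := by gcongr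
    have h3 : R ^ (m + 1) ≤ R ^ (k + 1) :=
      pow_le_pow_right₀ hR (by simpa using hm)
    exact mul_le_mul (hC _) (h2.trans h3) (by positivity) hC0
  have h4 : ((k : ℝ) + 1) ≤ 2 ^ k := by exact_mod_cast Nat.lt_two_pow_self (n := k)
  calc ‖convSeries f k w‖ ≤ ∑ m ∈ Finset.range (k + 1), C * R ^ (k + 1) := norm_sum_le_of_le _ h1
    _ = (k + 1) * (C * R ^ (k + 1)) := by simp
    _ ≤ 2 ^ k * (C * R ^ (k + 1)) := mul_le_mul_of_nonneg_right h4 (by positivity)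
    _ = C * R * (2 * R) ^ k := by rw [mul_pow]; ring

theorem differentiable_tailSeries (hf : RapidSeq f) (k : ℕ) :
    Differentiable ℂ (tailSeries f k) :=
  (hf.shift k).differentiable_tsum_mul_pow

theorem differentiable_convSeries (f : ℕ → ℂ) (k : ℕ) : Differentiable ℂ (convSeries f k) := by
  unfold convSeries
  fun_prop

theorem differentiable_tsum_tailSeries (hf : RapidSeq f) :
    Differentiable ℂ fun w => ∑' k, starRingEnd ℂ (f k) * tailSeries f k w :=
  hf.conj.differentiable_tsum hf.differentiable_tailSeries fun _ => hf.tailSeries_bound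

theorem differentiable_tsum_convSeries (hf : RapidSeq f) :
    Differentiable ℂ fun w => ∑' k, starRingEnd ℂ (f k) * convSeries f k w :=
  hf.conj.differentiable_tsum (differentiable_convSeries f) fun _ => hf.convSeries_bound

theorem summable_convSeries (hf : RapidSeq f) (w : ℂ) :
    Summable fun k => starRingEnd ℂ (f k) * convSeries f k w := by
  obtain ⟨C, q, hq, h⟩ := hf.convSeries_bound (R := ‖w‖ + 1) (by linarith [norm_nonneg w])
  exact hf.conj.summable_mul hq fun k => h k w (by linarith)

theorem summable_tailSeries (hf : RapidSeq f) (w : ℂ) :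
    Summable fun k => starRingEnd ℂ (f k) * tailSeries f k w := by
  obtain ⟨C, q, hq, h⟩ := hf.tailSeries_bound (R := ‖w‖ + 1) (by linarith [norm_nonneg w])
  exact hf.conj.summable_mul hq fun k => h k w (by linarith)

/-- For `|w| < 1` the only bounded solution of `x k = w (x (k + 1) - f k)` is the series. -/
theorem eq_neg_tailSeries (hf : RapidSeq f) {x : ℕ → ℂ} {B : ℝ} (hB : ∀ k, ‖x k‖ ≤ B) {w : ℂ}
    (hw : ‖w‖ < 1) (h : ∀ k, x k = w * (x (k + 1) - f k)) (k : ℕ) :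
    x k = -tailSeries f k w := by
  have h1 : ∀ n, ∑ m ∈ Finset.range n, f (k + m) * w ^ (m + 1) = w ^ n * x (k + n) - x k := by
    intro n
    induction n with
    | zero => simp
    | succ n ih =>
      rw [Finset.sum_range_succ, ih, h (k + n), ← add_assoc]
      ring
  have h2 : Tendsto (fun n => w ^ n * x (k + n)) atTop (𝓝 0) := by
    refine squeeze_zero_norm (a := fun n => ‖w‖ ^ n * B) (fun n => ?_) ?_
    · rw [norm_mul, norm_pow]
      exact mul_le_mul_of_nonneg_left (hB _) (by positivity)
    · simpa using (tendsto_pow_atTop_nhds_zero_of_lt_one (norm_nonneg w) hw).mul_const B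
  have h3 := ((hf.shift k).summable_mul_pow w).hasSum.tendsto_sum_nat
  simp only [h1] at h3
  have h4 := tendsto_nhds_unique h3 (h2.sub_const (x k))
  have h5 : tailSeries f k w = 0 - x k := h4
  rw [h5]; ring

/-- The solution of `x k = w (x (k - 1) - f k)`, where `e` plays the role of `x (-1)`. -/
theorem eq_sub_convSeries {x : ℕ → ℂ} {w e : ℂ} (h0 : x 0 = w * (e - f 0))
    (h : ∀ k, x (k + 1) = w * (x k - f (k + 1))) (k : ℕ) :
    x k = w ^ (k + 1) * e - convSeries f k w := by
  induction k with
  | zero => simp [convSeries, h0]; ring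
  | succ k ih =>
    rw [h k, ih, convSeries, convSeries, Finset.sum_range_succ' _ (k + 1)]
    simp only [Nat.add_sub_add_right, mul_sub, Finset.mul_sum, Nat.sub_zero]
    have : ∀ m, w * (f (k - m) * w ^ (m + 1)) = f (k - m) * w ^ (m + 1 + 1) := fun m => by ring
    simp only [this]
    ring

end RapidSeq

namespace TailGraph

variable {V : Type*} {N : ℕ} {Γ : TailGraph V N}

/-! ### Poles of finite rank -/

theorem hasFiniteRankPoleAt_of_analyticAt {G : Γ.decaySpace → ℂ → ℂ} {z₀ : ℂ}
    (hG : ∀ φ, AnalyticAt ℂ (G φ) z₀) : HasFiniteRankPoleAt G z₀ :=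
  ⟨0, fun _ => 0, fun m => m.elim0, fun φ => ⟨G φ, hG φ, by simp⟩⟩

theorem HasFiniteRankPoleAt.congr {G G' : Γ.decaySpace → ℂ → ℂ} {z₀ : ℂ}
    (hG : HasFiniteRankPoleAt G z₀) (h : ∀ φ, G' φ =ᶠ[𝓝[≠] z₀] G φ) :
    HasFiniteRankPoleAt G' z₀ := by
  obtain ⟨M, B, hB, hP⟩ := hG
  refine ⟨M, B, hB, fun φ => ?_⟩
  obtain ⟨g, hg, he⟩ := hP φ
  refine ⟨g, hg, ?_⟩
  filter_upwards [he, h φ] with z h1 h2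
  rw [h2, h1]

theorem HasFiniteRankPoleAt.meromorphicAt {G : Γ.decaySpace → ℂ → ℂ} {z₀ : ℂ}
    (h : HasFiniteRankPoleAt G z₀) (φ : Γ.decaySpace) : MeromorphicAt (G φ) z₀ := by
  obtain ⟨M, B, -, hP⟩ := h
  obtain ⟨g, hg, he⟩ := hP φ
  refine MeromorphicAt.congr ?_ (EventuallyEq.symm he)
  have := hg.meromorphicAt
  fun_prop

theorem finiteDimensional_range_add {B B' : Γ.decaySpace →ₗ⋆[ℂ] Γ.decaySpace →ₗ[ℂ] ℂ}
    (h : FiniteDimensional ℂ (LinearMap.range B)) (h' : FiniteDimensional ℂ (LinearMap.range B')) :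
    FiniteDimensional ℂ (LinearMap.range (B + B')) := by
  have hle : LinearMap.range (B + B') ≤ LinearMap.range B ⊔ LinearMap.range B' := by
    rintro _ ⟨x, rfl⟩
    exact Submodule.add_mem_sup ⟨x, rfl⟩ ⟨x, rfl⟩
  exact Submodule.finiteDimensional_of_le hle

/-- Finite-rank poles can be written with principal parts of any larger length. -/
theorem HasFiniteRankPoleAt.exists_forall_le {G : Γ.decaySpace → ℂ → ℂ} {z₀ : ℂ}
    (hG : HasFiniteRankPoleAt G z₀) :
    ∃ (M : ℕ) (B : ℕ → Γ.decaySpace →ₗ⋆[ℂ] Γ.decaySpace →ₗ[ℂ] ℂ),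
      (∀ m, FiniteDimensional ℂ (LinearMap.range (B m))) ∧ ∀ M', M ≤ M' →
      ∀ φ, ∃ h : ℂ → ℂ, AnalyticAt ℂ h z₀ ∧ ∀ᶠ z in 𝓝[≠] z₀,
        G φ z = ∑ m ∈ Finset.range M', B m φ φ * ((z - z₀) ^ (m + 1))⁻¹ + h z := by
  obtain ⟨M, B, hB, hP⟩ := hG
  refine ⟨M, fun m => if h : m < M then B ⟨m, h⟩ else 0, fun m => ?_, fun M' hM φ => ?_⟩
  · beta_reduce
    by_cases h : m < M
    · rw [dif_pos h]
      exact hB ⟨m, h⟩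
    · rw [dif_neg h, LinearMap.range_zero]
      infer_instance
  · obtain ⟨g, hg, he⟩ := hP φ
    refine ⟨g, hg, ?_⟩
    filter_upwards [he] with z hz
    rw [hz, Finset.sum_fin_eq_sum_range]
    congr 1
    rw [← Finset.sum_subset (Finset.range_subset_range.2 hM)]
    · refine Finset.sum_congr rfl fun m hm => ?_
      simp [Finset.mem_range.1 hm]
    · intro m _ hm
      simp [Finset.mem_range.not.1 hm]

theorem HasFiniteRankPoleAt.add {G G' : Γ.decaySpace → ℂ → ℂ} {z₀ : ℂ}
    (hG : HasFiniteRankPoleAt G z₀) (hG' : HasFiniteRankPoleAt G' z₀) :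
    HasFiniteRankPoleAt (fun φ z => G φ z + G' φ z) z₀ := by
  obtain ⟨M, B, hB, hP⟩ := hG.exists_forall_le
  obtain ⟨M', B', hB', hP'⟩ := hG'.exists_forall_le
  refine ⟨max M M', fun m => B m + B' m, fun m => finiteDimensional_range_add (hB m) (hB' m),
    fun φ => ?_⟩
  obtain ⟨g, hg, he⟩ := hP _ (le_max_left M M') φ
  obtain ⟨g', hg', he'⟩ := hP' _ (le_max_right M M') φ
  refine ⟨g + g', hg.add hg', ?_⟩
  filter_upwards [he, he'] with z h h'
  rw [h, h', Finset.sum_range, Finset.sum_range]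
  simp only [LinearMap.add_apply, add_mul, Finset.sum_add_distrib, Pi.add_apply]
  ring

theorem HasFiniteRankPoleAt.sum {ι : Type*} (s : Finset ι) {G : ι → Γ.decaySpace → ℂ → ℂ} {z₀ : ℂ}
    (hG : ∀ i ∈ s, HasFiniteRankPoleAt (G i) z₀) :
    HasFiniteRankPoleAt (fun φ z => ∑ i ∈ s, G i φ z) z₀ := by
  induction s using Finset.induction_on with
  | empty => simpa using hasFiniteRankPoleAt_of_analyticAt fun _ => analyticAt_const
  | insert i s hi ih =>
    simp only [Finset.sum_insert hi]
    exact (hG i (by simp)).add (ih fun j hj => hG j (by simp [hj]))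

/-- The product of an antilinear and of a linear functional, as a sesquilinear form. -/
noncomputable def rankOne (α : Γ.decaySpace →ₗ⋆[ℂ] ℂ) (β : Γ.decaySpace →ₗ[ℂ] ℂ) :
    Γ.decaySpace →ₗ⋆[ℂ] Γ.decaySpace →ₗ[ℂ] ℂ where
  toFun φ := α φ • β
  map_add' φ ψ := by rw [map_add, add_smul]
  map_smul' c φ := by rw [LinearMap.map_smulₛₗ, smul_eq_mul, mul_smul]

theorem finiteDimensional_range_rankOne (α : Γ.decaySpace →ₗ⋆[ℂ] ℂ) (β : Γ.decaySpace →ₗ[ℂ] ℂ) :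
    FiniteDimensional ℂ (LinearMap.range (rankOne α β)) := by
  have hle : LinearMap.range (rankOne α β) ≤ Submodule.span ℂ {β} := by
    rintro _ ⟨x, rfl⟩
    exact Submodule.smul_mem _ _ (Submodule.mem_span_singleton_self β)
  exact Submodule.finiteDimensional_of_le hle

theorem hasFiniteRankPoleAt_rankOne (α : Γ.decaySpace →ₗ⋆[ℂ] ℂ) (β : Γ.decaySpace →ₗ[ℂ] ℂ)
    (z₀ : ℂ) (M : ℕ) :
    HasFiniteRankPoleAt (fun φ z => ((z - z₀) ^ (M + 1))⁻¹ * (α φ * β φ)) z₀ := by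
  refine ⟨M + 1, fun m => if (m : ℕ) = M then rankOne α β else 0, fun m => ?_, fun φ =>
    ⟨0, analyticAt_const, Eventually.of_forall fun z => ?_⟩⟩
  · beta_reduce
    by_cases h : (m : ℕ) = M
    · rw [if_pos h]
      exact finiteDimensional_range_rankOne α β
    · rw [if_neg h, LinearMap.range_zero]
      infer_instance
  · rw [Fin.sum_univ_castSucc, Finset.sum_eq_zero]
    · simp [rankOne]
      ring
    · intro m _
      simp [m.2.ne]

/-- The difference quotient at `z₀` of a semilinear family of functions that are differentiable
there. -/
noncomputable def dslopeMap {σ : ℂ →+* ℂ} (α : Γ.decaySpace →ₛₗ[σ] ℂ → ℂ) (z₀ : ℂ)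
    (h : ∀ φ, DifferentiableAt ℂ (α φ) z₀) : Γ.decaySpace →ₛₗ[σ] ℂ → ℂ where
  toFun φ := dslope (α φ) z₀
  map_add' φ ψ := by
    funext z
    by_cases hz : z = z₀
    · subst hz
      simp only [dslope_same, Pi.add_apply, map_add]
      exact deriv_add (h φ) (h ψ)
    · simp only [Pi.add_apply, dslope_of_ne _ hz, slope_def_field, map_add]
      ring
  map_smul' c φ := by
    funext z
    by_cases hz : z = z₀
    · subst hz
      simp only [dslope_same, Pi.smul_apply, LinearMap.map_smulₛₗ]
      exact deriv_const_smul (σ c) (h φ)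
    · simp only [Pi.smul_apply, dslope_of_ne _ hz, slope_def_field, LinearMap.map_smulₛₗ,
        smul_eq_mul]
      ring

theorem analyticAt_dslope {f : ℂ → ℂ} {z₀ : ℂ} (h : AnalyticAt ℂ f z₀) :
    AnalyticAt ℂ (dslope f z₀) z₀ := by
  obtain ⟨p, hp⟩ := h
  exact ⟨_, hp.has_fpower_series_dslope_fslope⟩

theorem eq_add_mul_dslope (f : ℂ → ℂ) (z₀ z : ℂ) : f z = f z₀ + (z - z₀) * dslope f z₀ z := by
  have := sub_smul_dslope f z₀ z
  rw [smul_eq_mul] at this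
  rw [this]
  ring

/-- A product of analytic families of functionals, divided by a power of `z - z₀`, has a pole of
finite rank: expand both factors at `z₀`, one order at a time. -/
theorem hasFiniteRankPoleAt_mul (z₀ : ℂ) (M : ℕ) : ∀ (α : Γ.decaySpace →ₗ⋆[ℂ] ℂ → ℂ)
    (β : Γ.decaySpace →ₗ[ℂ] ℂ → ℂ) (_ : ∀ φ, AnalyticAt ℂ (α φ) z₀)
    (_ : ∀ φ, AnalyticAt ℂ (β φ) z₀),
    HasFiniteRankPoleAt (fun φ z => ((z - z₀) ^ M)⁻¹ * (α φ z * β φ z)) z₀ := by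
  induction M with
  | zero =>
    intro α β hα hβ
    refine hasFiniteRankPoleAt_of_analyticAt fun φ => ?_
    simpa only [pow_zero, inv_one, one_mul] using (hα φ).fun_mul (hβ φ)
  | succ M ih =>
    intro α β hα hβ
    let α₀ : Γ.decaySpace →ₗ⋆[ℂ] ℂ := (LinearMap.proj (R := ℂ) (φ := fun _ : ℂ => ℂ) z₀).comp α
    let β₀ : Γ.decaySpace →ₗ[ℂ] ℂ := (LinearMap.proj (R := ℂ) (φ := fun _ : ℂ => ℂ) z₀).comp β
    let c₀ : ℂ →ₗ[ℂ] (ℂ → ℂ) := LinearMap.pi fun _ => LinearMap.id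
    have hα₀ : ∀ φ, AnalyticAt ℂ (c₀.comp α₀ φ) z₀ := fun φ => analyticAt_const
    have hα' : ∀ φ, AnalyticAt ℂ (dslopeMap α z₀ (fun φ => (hα φ).differentiableAt) φ) z₀ :=
      fun φ => analyticAt_dslope (hα φ)
    have hβ' : ∀ φ, AnalyticAt ℂ (dslopeMap β z₀ (fun φ => (hβ φ).differentiableAt) φ) z₀ :=
      fun φ => analyticAt_dslope (hβ φ)
    refine (((hasFiniteRankPoleAt_rankOne α₀ β₀ z₀ M).add (ih _ _ hα₀ hβ')).add
      (ih _ _ hα' hβ)).congr fun φ => ?_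
    filter_upwards [self_mem_nhdsWithin] with z hz
    have hz' : z - z₀ ≠ 0 := sub_ne_zero.2 hz
    change _ = ((z - z₀) ^ (M + 1))⁻¹ * (α φ z₀ * β φ z₀) +
      ((z - z₀) ^ M)⁻¹ * (α φ z₀ * dslope (β φ) z₀ z) +
      ((z - z₀) ^ M)⁻¹ * (dslope (α φ) z₀ z * β φ z)
    rw [eq_add_mul_dslope (α φ) z₀ z, eq_add_mul_dslope (β φ) z₀ z, pow_succ]
    field_simp

/-! ### Internal edges and tails -/

/-- The internal oriented edges. -/
def IntArc (Γ : TailGraph V N) : Type _ := {p : V × V // Γ.Adj p.1 p.2}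

/-- An internal edge as an edge of the whole graph. -/
def IntArc.arc (a : Γ.IntArc) : Γ.Arc := Arc.int a.1.1 a.1.2 a.2

noncomputable instance [Finite V] : Fintype Γ.IntArc :=
  have : Finite Γ.IntArc := inferInstanceAs (Finite {p : V × V // Γ.Adj p.1 p.2})
  Fintype.ofFinite _

theorem IntArc.arc_injective : Function.Injective (IntArc.arc (Γ := Γ)) := by
  rintro ⟨⟨u, w⟩, h⟩ ⟨⟨u', w'⟩, h'⟩ he
  simp only [IntArc.arc, Arc.int.injEq] at he
  obtain ⟨rfl, rfl⟩ := he
  rfl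

/-- Induction over the three kinds of edges. -/
theorem Arc.forall_of {P : Γ.Arc → Prop} (h1 : ∀ a : Γ.IntArc, P a.arc)
    (h2 : ∀ j k, P (Arc.flat j k)) (h3 : ∀ j k, P (Arc.sharp j k)) (a : Γ.Arc) : P a := by
  rcases a with ⟨u, w, h⟩ | ⟨j, k⟩ | ⟨j, k⟩
  · exact h1 ⟨(u, w), h⟩
  · exact h2 j k
  · exact h3 j k

/-- A sum over all edges splits into the internal sum and the sums along the tails. -/
theorem hasSum_arc [Finite V] {E : Type*} [AddCommMonoid E] [TopologicalSpace E] [ContinuousAdd E]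
    {f : Γ.Arc → E} {s t : Fin N → E} (hs : ∀ j, HasSum (fun k => f (Arc.flat j k)) (s j))
    (ht : ∀ j, HasSum (fun k => f (Arc.sharp j k)) (t j)) :
    HasSum f (∑ a : Γ.IntArc, f a.arc + ∑ j, s j + ∑ j, t j) := by
  have h1 : HasSum (fun a : Γ.Arc => match a with
      | Arc.int _ _ _ => f a | _ => 0) (∑ a : Γ.IntArc, f a.arc) := by
    refine (IntArc.arc_injective.hasSum_iff ?_).1 (hasSum_fintype _)
    refine Arc.forall_of (fun a h => (h ⟨a, rfl⟩).elim) (fun _ _ _ => rfl) (fun _ _ _ => rfl)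
  have h2 : ∀ j, HasSum (fun a : Γ.Arc => match a with
      | Arc.flat i _ => if i = j then f a else 0 | _ => 0) (s j) := by
    intro j
    refine ((Function.Injective.hasSum_iff (g := fun k => (Arc.flat j k : Γ.Arc))
      (fun k l h => by simpa using h) ?_).1 (by simpa [Function.comp_def] using hs j))
    refine Arc.forall_of (fun _ _ => rfl) (fun i k h => if_neg ?_) (fun _ _ _ => rfl)
    rintro rfl
    exact h ⟨k, rfl⟩
  have h3 : ∀ j, HasSum (fun a : Γ.Arc => match a with
      | Arc.sharp i _ => if i = j then f a else 0 | _ => 0) (t j) := by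
    intro j
    refine ((Function.Injective.hasSum_iff (g := fun k => (Arc.sharp j k : Γ.Arc))
      (fun k l h => by simpa using h) ?_).1 (by simpa [Function.comp_def] using ht j))
    refine Arc.forall_of (fun _ _ => rfl) (fun _ _ _ => rfl) (fun i k h => if_neg ?_)
    rintro rfl
    exact h ⟨k, rfl⟩
  convert (h1.add (hasSum_sum fun j _ => h2 j)).add (hasSum_sum fun j _ => h3 j) using 1
  funext a
  rcases a with ⟨u, w, h⟩ | ⟨j, k⟩ | ⟨j, k⟩ <;> simp

/-! ### Rapidly decaying states -/

theorem rapidSeq_of_exp {f : ℕ → ℂ}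
    (h : ∀ τ : ℝ, 0 < τ → Tendsto (fun k : ℕ => Real.exp (τ * k) * ‖f k‖) atTop (𝓝 0)) :
    RapidSeq f := by
  intro r hr
  have hm : 1 < max 2 r := lt_of_lt_of_le one_lt_two (le_max_left _ _)
  obtain ⟨C, hC⟩ := (h (Real.log (max 2 r)) (Real.log_pos hm)).bddAbove_range
  refine ⟨C, fun k => le_trans ?_ (hC ⟨k, rfl⟩)⟩
  beta_reduce
  rw [mul_comm (Real.log _), Real.exp_nat_mul, Real.exp_log (by linarith), mul_comm]
  gcongr
  exact le_max_right _ _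

theorem RapidDecay.flat {ψ : Γ.Arc → ℂ} (h : RapidDecay ψ) (j : Fin N) :
    RapidSeq fun k => ψ (Arc.flat j k) :=
  rapidSeq_of_exp fun τ hτ => (h (τ + 1) (by linarith) τ ⟨hτ, by linarith⟩ j).1

theorem RapidDecay.sharp {ψ : Γ.Arc → ℂ} (h : RapidDecay ψ) (j : Fin N) :
    RapidSeq fun k => ψ (Arc.sharp j k) := by
  refine rapidSeq_of_exp fun τ hτ => ?_
  refine squeeze_zero (fun k => by positivity) (fun k => ?_)
    (h (τ + 1) (by linarith) τ ⟨hτ, by linarith⟩ j).2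
  gcongr
  linarith

theorem _root_.RapidSeq.summable_sq {f : ℕ → ℂ} (h : RapidSeq f) :
    Summable fun k => ‖f k‖ ^ 2 := by
  obtain ⟨C, hC⟩ := h 1 one_pos
  have := (h.summable_mul (g := fun k => starRingEnd ℂ (f k)) (C := C) (q := 1) one_pos
    (fun k => by simpa using hC k)).norm
  simpa [pow_two] using this

theorem memℓp_two_of_summable [Finite V] {ψ : Γ.Arc → ℂ}
    (h1 : ∀ j, Summable fun k => ‖ψ (Arc.flat j k)‖ ^ 2)
    (h2 : ∀ j, Summable fun k => ‖ψ (Arc.sharp j k)‖ ^ 2) : Memℓp ψ 2 := by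
  refine memℓp_gen ?_
  simpa using (hasSum_arc (f := fun a => ‖ψ a‖ ^ 2) (fun j => (h1 j).hasSum)
    (fun j => (h2 j).hasSum)).summable

theorem RapidDecay.memℓp [Finite V] {ψ : Γ.Arc → ℂ} (h : RapidDecay ψ) : Memℓp ψ 2 :=
  memℓp_two_of_summable (fun j => (h.flat j).summable_sq) (fun j => (h.sharp j).summable_sq)

theorem rapidDecay_of_eventually_zero {ψ : Γ.Arc → ℂ}
    (h : ∀ j, ∀ᶠ k in atTop, ψ (Arc.flat j k) = 0 ∧ ψ (Arc.sharp j k) = 0) : RapidDecay ψ := by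
  intro γ _ τ _ j
  constructor
  · refine tendsto_const_nhds.congr' ?_
    filter_upwards [h j] with k hk
    simp [hk.1]
  · refine tendsto_const_nhds.congr' ?_
    filter_upwards [h j] with k hk
    simp [hk.2]

theorem single_mem_decaySpace (a : Γ.Arc) (c : ℂ) : lp.single 2 a c ∈ Γ.decaySpace := by
  refine rapidDecay_of_eventually_zero fun j => ?_
  have hs : ∀ g : ℕ → Γ.Arc, Function.Injective g →
      ∀ᶠ k in atTop, (lp.single 2 a c : Γ.H) (g k) = 0 := by
    intro g hg
    have : ∀ᶠ k in atTop, g k ≠ a := by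
      rw [← Nat.cofinite_eq_atTop]
      exact hg.tendsto_cofinite.eventually (eventually_cofinite_ne a)
    filter_upwards [this] with k hk
    exact lp.single_apply_ne _ _ _ hk
  exact (hs (Arc.flat j) fun k l h => by simpa using h).and
    (hs (Arc.sharp j) fun k l h => by simpa using h)

theorem dense_decaySpace : Dense (Γ.decaySpace : Set Γ.H) := by
  intro x
  refine mem_closure_of_tendsto (lp.hasSum_single (by norm_num) x)
    (Eventually.of_forall fun s => ?_)
  exact Submodule.sum_mem _ fun a _ => single_mem_decaySpace a _

/-- A vector on the internal edges, extended by zero to the tails. -/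
noncomputable def intExt [Finite V] (v : Γ.IntArc → ℂ) : Γ.decaySpace :=
  have h : RapidDecay (fun a : Γ.Arc => match a with
      | Arc.int u w h => v ⟨(u, w), h⟩ | _ => 0) :=
    rapidDecay_of_eventually_zero fun _ => Eventually.of_forall fun _ => ⟨rfl, rfl⟩
  ⟨⟨_, h.memℓp⟩, h⟩

section intExt
variable [Finite V] (v : Γ.IntArc → ℂ)

@[simp] theorem intExt_arc (a : Γ.IntArc) : (intExt v : Γ.H) a.arc = v a := rfl
@[simp] theorem intExt_flat (j : Fin N) (k : ℕ) : (intExt v : Γ.H) (Arc.flat j k) = 0 := rfl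
@[simp] theorem intExt_sharp (j : Fin N) (k : ℕ) : (intExt v : Γ.H) (Arc.sharp j k) = 0 := rfl

end intExt

namespace QuantumWalk

variable [Finite V] (W : QuantumWalk Γ)

/-! ### The internal matrix -/

/-- The amplitude of the transition from `b` to `a` in one step of the walk. -/
noncomputable def amp (a b : Γ.Arc) : ℂ := W.evol (Pi.single b 1) a

/-- On the edges that leave an internal vertex, one step of the walk depends only on the
internal edges and on the last edges of the incoming tails. -/
theorem evol_eq_sum (ψ : Γ.Arc → ℂ) {a : Γ.Arc} {x : V} (ha : a.rev.ter = Sum.inl x) :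
    W.evol ψ a = ∑ b : Γ.IntArc, W.amp a b.arc * ψ b.arc +
      ∑ j, W.amp a (Arc.flat j 0) * ψ (Arc.flat j 0) := by
  -- `χ` is the restriction of `ψ` to the edges that end at internal vertices.
  let χ : Γ.Arc → ℂ := ∑ b : Γ.IntArc, ψ b.arc • Pi.single b.arc 1 +
    ∑ j, ψ (Arc.flat j 0) • Pi.single (Arc.flat j 0) 1
  have h1 : W.evol χ a = ∑ b : Γ.IntArc, W.amp a b.arc * ψ b.arc +
      ∑ j, W.amp a (Arc.flat j 0) * ψ (Arc.flat j 0) := by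
    simp only [χ, map_add, map_sum, map_smul, Pi.add_apply, Finset.sum_apply, Pi.smul_apply,
      smul_eq_mul, amp, mul_comm]
  rw [← h1]
  change (∑ b : Γ.InArc a.rev.ter, W.coin a.rev.ter ⟨a.rev, rfl⟩ b * ψ b) =
    ∑ b : Γ.InArc a.rev.ter, W.coin a.rev.ter ⟨a.rev, rfl⟩ b * χ b
  refine Finset.sum_congr rfl fun b _ => ?_
  congr 1
  obtain ⟨b, hb⟩ := b
  rw [ha] at hb
  change ψ b = χ b
  rcases b with ⟨u, w, h⟩ | ⟨j, k⟩ | ⟨j, k⟩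
  · change ψ (IntArc.arc ⟨(u, w), h⟩) = χ (IntArc.arc ⟨(u, w), h⟩)
    obtain ⟨c, hc⟩ : ∃ c : Γ.IntArc, c = ⟨(u, w), h⟩ := ⟨_, rfl⟩
    rw [← hc]
    have h2 : ∀ j, c.arc ≠ Arc.flat j 0 := fun j => by simp [IntArc.arc]
    simp [χ, Finset.sum_apply, Pi.single_apply, IntArc.arc_injective.eq_iff, h2]
  · cases k with
    | zero =>
      have h2 : ∀ c : Γ.IntArc, Arc.flat j 0 ≠ c.arc := fun j => by simp [IntArc.arc]
      simp [χ, Finset.sum_apply, Pi.single_apply, h2]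
    | succ k => simp [Arc.ter, vert] at hb
  · simp [Arc.ter, vert] at hb

theorem evol_arc (ψ : Γ.Arc → ℂ) (a : Γ.IntArc) :
    W.evol ψ a.arc = ∑ b : Γ.IntArc, W.amp a.arc b.arc * ψ b.arc +
      ∑ j, W.amp a.arc (Arc.flat j 0) * ψ (Arc.flat j 0) :=
  W.evol_eq_sum ψ (x := a.1.1) rfl

theorem evol_sharp_zero (ψ : Γ.Arc → ℂ) (j : Fin N) :
    W.evol ψ (Arc.sharp j 0) = ∑ b : Γ.IntArc, W.amp (Arc.sharp j 0) b.arc * ψ b.arc +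
      ∑ i, W.amp (Arc.sharp j 0) (Arc.flat i 0) * ψ (Arc.flat i 0) :=
  W.evol_eq_sum ψ (x := Γ.base j) rfl

theorem evol_flat (ψ : Γ.Arc → ℂ) (j : Fin N) (k : ℕ) :
    W.evol ψ (Arc.flat j k) = ψ (Arc.flat j (k + 1)) := W.free_flat ψ j k

theorem evol_sharp_succ (ψ : Γ.Arc → ℂ) (j : Fin N) (k : ℕ) :
    W.evol ψ (Arc.sharp j (k + 1)) = ψ (Arc.sharp j k) := W.free_sharp ψ j k

/-- The compression of the evolution to the internal edges, shifted by `λ = e^{-iz}`. -/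
noncomputable def pencil (z : ℂ) : Matrix Γ.IntArc Γ.IntArc ℂ :=
  Matrix.of (fun a b : Γ.IntArc => W.amp a.arc b.arc) - Complex.exp (-(Complex.I * z)) • 1

theorem pencil_mulVec (z : ℂ) (v : Γ.IntArc → ℂ) (a : Γ.IntArc) :
    (W.pencil z).mulVec v a =
      ∑ b : Γ.IntArc, W.amp a.arc b.arc * v b - Complex.exp (-(Complex.I * z)) * v a := by
  rw [pencil, Matrix.sub_mulVec, Matrix.smul_mulVec, Matrix.one_mulVec]
  rfl

theorem norm_exp_neg (z : ℂ) : ‖Complex.exp (-(Complex.I * z))‖ = Real.exp z.im := by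
  simp [Complex.norm_exp]

/-- The internal matrix is a contraction, hence has no eigenvalue outside the unit disc. -/
theorem det_pencil_ne_zero {z : ℂ} (hz : 0 < z.im) : (W.pencil z).det ≠ 0 := by
  intro h
  obtain ⟨v, hv, hv'⟩ := Matrix.exists_mulVec_eq_zero_iff.2 h
  -- `U x` agrees with `e^{-iz} x` on the internal edges, and `x` vanishes on the tails.
  set x : Γ.H := (intExt v : Γ.H) with hx
  have h1 : ‖Complex.exp (-(Complex.I * z)) • x‖ ≤ ‖W.U x‖ := by
    refine lp.norm_mono two_ne_zero ?_
    refine Arc.forall_of (fun a => ?_) (fun j k => ?_) (fun j k => ?_)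
    · have h2 := congrFun hv' a
      rw [pencil_mulVec, Pi.zero_apply, sub_eq_zero] at h2
      rw [U_apply, evol_arc]
      simp [hx, h2]
    · simp [hx]
    · simp [hx]
  have h3 := h1.trans (W.norm_U_le x)
  rw [norm_smul, norm_exp_neg] at h3
  have h4 : x ≠ 0 := by
    intro h0
    refine hv (funext fun a => ?_)
    have := congrArg (fun y : Γ.H => y a.arc) h0
    simpa [hx] using this
  have h5 : 1 < Real.exp z.im := Real.one_lt_exp_iff.2 hz
  nlinarith [norm_pos_iff.2 h4]

theorem isDistortedEigenvalue_iff (θ μ : ℂ) :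
    W.IsDistortedEigenvalue θ μ ↔ ∃ x : Γ.H, x ≠ 0 ∧ ∀ a, W.distortedEvol θ x a = μ * x a := by
  rw [IsDistortedEigenvalue]
  constructor
  · intro h
    obtain ⟨x, hx⟩ := h.exists_hasEigenvector
    refine ⟨x, hx.2, fun a => ?_⟩
    have := congrArg (fun y : Γ.H => y a) hx.apply_eq_smul
    exact this
  · rintro ⟨x, hx, h⟩
    refine Module.End.hasEigenvalue_of_hasEigenvector (x := x)
      ⟨Module.End.mem_eigenspace_iff.2 ?_, hx⟩
    ext a
    exact h a

/-- The eigenvalues of the distorted evolution outside the disc of radius `e^{Im θ}` are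
those of the internal matrix: an eigenvector vanishes on the incoming tails, where it would grow,
and is a geometric sequence on the outgoing ones. -/
theorem isDistortedEigenvalue_iff_det {θ z : ℂ} (h : θ.im < z.im) :
    W.IsDistortedEigenvalue θ (Complex.exp (-(Complex.I * z))) ↔ (W.pencil z).det = 0 := by
  rw [isDistortedEigenvalue_iff, ← Matrix.exists_mulVec_eq_zero_iff]
  set μ := Complex.exp (-(Complex.I * z)) with hμ
  set ε := Complex.exp (-(Complex.I * θ)) with hε
  have hμ0 : μ ≠ 0 := Complex.exp_ne_zero _
  have hε0 : ε ≠ 0 := Complex.exp_ne_zero _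
  have hρ : ‖ε‖ < ‖μ‖ := by
    rw [hμ, hε, norm_exp_neg, norm_exp_neg]
    exact Real.exp_lt_exp.2 h
  constructor
  · rintro ⟨x, hx, hex⟩
    -- On an incoming tail `x` is geometric of ratio `μ / ε`, which exceeds `1` in modulus.
    have hf0 : ∀ j, x (Arc.flat j 0) = 0 := by
      intro j
      have hp : ∀ k, x (Arc.flat j k) = (μ / ε) ^ k * x (Arc.flat j 0) := by
        intro k
        induction k with
        | zero => simp
        | succ k ih =>
          have h1 := hex (Arc.flat j k)
          rw [distortedEvol_apply, evol_flat] at h1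
          change ε * _ = _ at h1
          rw [pow_succ', mul_assoc, ← ih]
          field_simp
          rw [mul_comm, h1]
      by_contra h0
      have h2 : 1 < ‖μ / ε‖ := by
        rw [norm_div, one_lt_div (norm_pos_iff.2 hε0)]
        exact hρ
      obtain ⟨k, hk⟩ := pow_unbounded_of_one_lt (‖x‖ / ‖x (Arc.flat j 0)‖) h2
      have h3 := lp.norm_apply_le_norm two_ne_zero x (Arc.flat j k)
      rw [hp k, norm_mul, norm_pow] at h3
      rw [div_lt_iff₀ (norm_pos_iff.2 h0)] at hk
      linarith
    have hf : ∀ j k, x (Arc.flat j k) = 0 := by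
      intro j k
      induction k with
      | zero => exact hf0 j
      | succ k ih =>
        have h1 := hex (Arc.flat j k)
        rw [distortedEvol_apply, evol_flat, ih, mul_zero] at h1
        exact (mul_eq_zero.1 h1).resolve_left hε0
    refine ⟨fun a => x a.arc, fun hv => hx ?_, funext fun a => ?_⟩
    · have hv' : ∀ a : Γ.IntArc, x a.arc = 0 := fun a => congrFun hv a
      ext a
      revert a
      refine Arc.forall_of hv' hf fun j k => ?_
      change x (Arc.sharp j k) = 0
      induction k with
      | zero =>
        have h1 := hex (Arc.sharp j 0)
        rw [distortedEvol_apply, evol_sharp_zero] at h1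
        simp only [hv', hf, mul_zero, Finset.sum_const_zero, add_zero] at h1
        exact (mul_eq_zero.1 h1.symm).resolve_left hμ0
      | succ k ih =>
        have h1 := hex (Arc.sharp j (k + 1))
        rw [distortedEvol_apply, evol_sharp_succ, ih, mul_zero] at h1
        exact (mul_eq_zero.1 h1.symm).resolve_left hμ0
    · have h1 := hex a.arc
      rw [distortedEvol_apply, evol_arc] at h1
      simp only [hf, mul_zero, Finset.sum_const_zero, add_zero] at h1
      rw [pencil_mulVec, Pi.zero_apply, sub_eq_zero, ← h1]
      exact (one_mul _).symm
  · rintro ⟨v, hv, hv'⟩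
    -- The outgoing tails carry a geometric sequence of ratio `ε / μ`, started by `v`.
    let ψ : Γ.Arc → ℂ := fun a => match a with
      | Arc.int u w h => v ⟨(u, w), h⟩
      | Arc.flat _ _ => 0
      | Arc.sharp j k => (ε / μ) ^ (k + 1) * ∑ b : Γ.IntArc, W.amp (Arc.sharp j 0) b.arc * v b
    have hψ : Memℓp ψ 2 := by
      refine memℓp_two_of_summable (fun j => by simp [ψ]) fun j => ?_
      have h1 : ‖ε / μ‖ ^ 2 < 1 := by
        rw [norm_div]
        exact pow_lt_one₀ (by positivity) ((div_lt_one (norm_pos_iff.2 hμ0)).2 hρ) two_ne_zero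
      refine ((summable_geometric_of_lt_one (by positivity) h1).mul_left
        (‖ε / μ‖ ^ 2 * ‖∑ b : Γ.IntArc, W.amp (Arc.sharp j 0) b.arc * v b‖ ^ 2)).congr fun k => ?_
      simp only [ψ, norm_mul, norm_pow]
      ring
    refine ⟨⟨ψ, hψ⟩, fun h0 => hv (funext fun a => ?_), ?_⟩
    · exact congrArg (fun y : Γ.H => y a.arc) h0
    · change ∀ a, W.distortedEvol θ ψ a = μ * ψ a
      have hi : ∀ a : Γ.IntArc, ψ a.arc = v a := fun _ => rfl
      have hf : ∀ j k, ψ (Arc.flat j k) = 0 := fun _ _ => rfl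
      have hs : ∀ j k, ψ (Arc.sharp j k) =
        (ε / μ) ^ (k + 1) * ∑ b : Γ.IntArc, W.amp (Arc.sharp j 0) b.arc * v b := fun _ _ => rfl
      refine Arc.forall_of (fun a => ?_) (fun j k => ?_) (fun j k => ?_)
      · rw [distortedEvol_apply, evol_arc]
        have h1 := congrFun hv' a
        rw [pencil_mulVec, Pi.zero_apply, sub_eq_zero] at h1
        simp only [hi, hf, h1, mul_zero, Finset.sum_const_zero, add_zero]
        exact one_mul _
      · rw [distortedEvol_apply, evol_flat, hf j (k + 1)]
        exact (mul_zero _).trans (mul_zero _).symm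
      · rw [distortedEvol_apply]
        cases k with
        | zero =>
          rw [evol_sharp_zero, hs]
          simp only [hi, hf, mul_zero, Finset.sum_const_zero, add_zero]
          change ε * _ = _
          rw [zero_add, pow_one]
          field_simp
        | succ k =>
          rw [evol_sharp_succ, hs, hs, pow_succ _ (k + 1)]
          change ε * _ = _
          field_simp

end QuantumWalk

namespace QuantumWalk

/-! ### The extended matrix element -/

/-- Minus the amplitude, at the last edge of the `j`-th incoming tail, of the solution of the
resolvent equation with source `φ`. -/
noncomputable def flatMap (j : Fin N) : Γ.decaySpace →ₗ[ℂ] ℂ → ℂ where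
  toFun φ z := ∑' k, (φ : Γ.H) (Arc.flat j k) * Complex.exp (Complex.I * z) ^ (k + 1)
  map_add' φ ψ := by
    funext z
    simp only [Submodule.coe_add, lp.coeFn_add, Pi.add_apply, add_mul]
    exact ((RapidDecay.flat φ.2 j).summable_mul_pow _).tsum_add
      ((RapidDecay.flat ψ.2 j).summable_mul_pow _)
  map_smul' c φ := by
    funext z
    simp only [Submodule.coe_smul, lp.coeFn_smul, Pi.smul_apply, smul_eq_mul, mul_assoc,
      RingHom.id_apply]
    exact tsum_mul_left

/-- The overlap of `φ` with a unit amplitude sent out along the `j`-th tail. -/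
noncomputable def sharpMap (j : Fin N) : Γ.decaySpace →ₗ⋆[ℂ] ℂ → ℂ where
  toFun φ z := ∑' k, starRingEnd ℂ ((φ : Γ.H) (Arc.sharp j k)) *
    Complex.exp (Complex.I * z) ^ (k + 1)
  map_add' φ ψ := by
    funext z
    simp only [Submodule.coe_add, lp.coeFn_add, Pi.add_apply, map_add, add_mul]
    exact ((RapidDecay.sharp φ.2 j).conj.summable_mul_pow _).tsum_add
      ((RapidDecay.sharp ψ.2 j).conj.summable_mul_pow _)
  map_smul' c φ := by
    funext z
    simp only [Submodule.coe_smul, lp.coeFn_smul, Pi.smul_apply, smul_eq_mul, mul_assoc, map_mul]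
    exact tsum_mul_left

theorem differentiable_flatMap (j : Fin N) (φ : Γ.decaySpace) :
    Differentiable ℂ (flatMap j φ) :=
  (RapidDecay.flat φ.2 j).differentiable_tsum_mul_pow.comp
    (g := fun w => ∑' k, (φ : Γ.H) (Arc.flat j k) * w ^ (k + 1)) (by fun_prop)

theorem differentiable_sharpMap (j : Fin N) (φ : Γ.decaySpace) :
    Differentiable ℂ (sharpMap j φ) :=
  (RapidDecay.sharp φ.2 j).conj.differentiable_tsum_mul_pow.comp
    (g := fun w => ∑' k, starRingEnd ℂ ((φ : Γ.H) (Arc.sharp j k)) * w ^ (k + 1)) (by fun_prop)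

variable [Finite V] (W : QuantumWalk Γ)

/-- The source seen by the internal edge `a`: the value of `φ` there, and what arrives from the
incoming tails. -/
noncomputable def source (a : Γ.IntArc) : Γ.decaySpace →ₗ[ℂ] ℂ → ℂ where
  toFun φ z := (φ : Γ.H) a.arc + ∑ j, W.amp a.arc (Arc.flat j 0) * flatMap j φ z
  map_add' φ ψ := by
    funext z
    simp only [Submodule.coe_add, lp.coeFn_add, Pi.add_apply, map_add, mul_add,
      Finset.sum_add_distrib]
    ring
  map_smul' c φ := by
    funext z
    simp only [Submodule.coe_smul, lp.coeFn_smul, Pi.smul_apply, smul_eq_mul, map_smul,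
      RingHom.id_apply, mul_add, Finset.mul_sum]
    congr 1
    exact Finset.sum_congr rfl fun j _ => by ring

/-- The overlap of `φ` with a unit amplitude on the internal edge `a` and the waves that it emits
into the outgoing tails. -/
noncomputable def probe (a : Γ.IntArc) : Γ.decaySpace →ₗ⋆[ℂ] ℂ → ℂ where
  toFun φ z := starRingEnd ℂ ((φ : Γ.H) a.arc) +
    ∑ j, W.amp (Arc.sharp j 0) a.arc * sharpMap j φ z
  map_add' φ ψ := by
    funext z
    simp only [Submodule.coe_add, lp.coeFn_add, Pi.add_apply, map_add, mul_add,
      Finset.sum_add_distrib]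
    ring
  map_smul' c φ := by
    funext z
    simp only [Submodule.coe_smul, lp.coeFn_smul, Pi.smul_apply, smul_eq_mul,
      LinearMap.map_smulₛₗ, map_mul, mul_add, Finset.mul_sum]
    congr 1
    exact Finset.sum_congr rfl fun j _ => by ring

theorem differentiable_source (a : Γ.IntArc) (φ : Γ.decaySpace) :
    Differentiable ℂ (W.source a φ) := by
  have := fun j => differentiable_flatMap j φ
  change Differentiable ℂ fun z => _ + ∑ j, _ * flatMap j φ z
  fun_prop

theorem differentiable_probe (a : Γ.IntArc) (φ : Γ.decaySpace) :
    Differentiable ℂ (W.probe a φ) := by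
  have := fun j => differentiable_sharpMap j φ
  change Differentiable ℂ fun z => _ + ∑ j, _ * sharpMap j φ z
  fun_prop

/-- The part of the matrix element that comes from the free motion along the tails and from the
direct transmission between tails.  It is entire. -/
noncomputable def regularPart (φ : Γ.decaySpace) (z : ℂ) : ℂ :=
  -∑ j, ∑' k, starRingEnd ℂ ((φ : Γ.H) (Arc.flat j k)) *
      RapidSeq.tailSeries (fun k => (φ : Γ.H) (Arc.flat j k)) k (Complex.exp (Complex.I * z)) -
    ∑ j, ∑' k, starRingEnd ℂ ((φ : Γ.H) (Arc.sharp j k)) *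
      RapidSeq.convSeries (fun k => (φ : Γ.H) (Arc.sharp j k)) k (Complex.exp (Complex.I * z)) -
    ∑ j, ∑ i, sharpMap j φ z * W.amp (Arc.sharp j 0) (Arc.flat i 0) * flatMap i φ z

theorem differentiable_regularPart (φ : Γ.decaySpace) : Differentiable ℂ (W.regularPart φ) := by
  have h1 := fun j => differentiable_flatMap j φ
  have h2 := fun j => differentiable_sharpMap j φ
  have h3 := fun j => (RapidDecay.flat φ.2 j).differentiable_tsum_tailSeries.comp
    (f := fun z => Complex.exp (Complex.I * z)) (by fun_prop)
  have h4 := fun j => (RapidDecay.sharp φ.2 j).differentiable_tsum_convSeries.comp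
    (f := fun z => Complex.exp (Complex.I * z)) (by fun_prop)
  simp only [Function.comp_def] at h3 h4
  unfold regularPart
  fun_prop

/-- The matrix element `⟨R(z) φ, φ⟩`, continued to the whole plane by solving the equation for the
resolvent along the tails and inverting the internal matrix.  At the zeros of the determinant of
that matrix, where the inverse is `0` by convention, its value is immaterial. -/
noncomputable def extF (φ : Γ.decaySpace) (z : ℂ) : ℂ :=
  W.regularPart φ z +
    ∑ a, ∑ b, W.probe a φ z * (W.pencil z)⁻¹ a b * W.source b φ z

theorem extF_periodic (φ : Γ.decaySpace) (z : ℂ) : W.extF φ (z + 2 * Real.pi) = W.extF φ z := by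
  have h1 : Complex.exp (Complex.I * (z + 2 * Real.pi)) = Complex.exp (Complex.I * z) := by
    rw [mul_add, show Complex.I * (2 * Real.pi) = 2 * Real.pi * Complex.I by ring]
    exact Complex.exp_periodic _
  have h2 : ∀ j, flatMap j φ (z + 2 * Real.pi) = flatMap j φ z := fun j => by
    simp only [flatMap, LinearMap.coe_mk, AddHom.coe_mk, h1]
  have h3 : ∀ j, sharpMap j φ (z + 2 * Real.pi) = sharpMap j φ z := fun j => by
    simp only [sharpMap, LinearMap.coe_mk, AddHom.coe_mk, h1]
  have h4 : W.pencil (z + 2 * Real.pi) = W.pencil z := by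
    simp only [pencil, Complex.exp_neg, h1]
  simp only [extF, regularPart, probe, source, LinearMap.coe_mk, AddHom.coe_mk, h1, h2, h3, h4]

theorem isUnit_sub_exp {z : ℂ} (hz : 0 < z.im) :
    IsUnit (W.U - Complex.exp (-(Complex.I * z)) • (1 : Γ.H →L[ℂ] Γ.H)) := by
  have h1 : ‖W.U‖ ≤ 1 := W.U.opNorm_le_bound zero_le_one fun x => by simpa using W.norm_U_le x
  have h2 : Complex.exp (-(Complex.I * z)) ∈ resolventSet ℂ W.U := by
    refine spectrum.mem_resolventSet_of_norm_lt_mul ?_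
    have h3 : ‖(1 : Γ.H →L[ℂ] Γ.H)‖ ≤ 1 := ContinuousLinearMap.norm_id_le
    have h4 : 1 < Real.exp z.im := Real.one_lt_exp_iff.2 hz
    rw [norm_exp_neg]
    calc ‖W.U‖ * ‖(1 : Γ.H →L[ℂ] Γ.H)‖ ≤ 1 * 1 := mul_le_mul h1 h3 (norm_nonneg _) zero_le_one
      _ < Real.exp z.im := by simpa using h4
  rw [spectrum.mem_resolventSet_iff, Algebra.algebraMap_eq_smul_one] at h2
  simpa using h2.neg

/-- In the upper half plane the resolvent equation is solved tail by tail: its solution is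
bounded, which determines it on the incoming tails. -/
theorem extF_eq_F (φ : Γ.decaySpace) {z : ℂ} (hz : 0 < z.im) : W.extF φ z = W.F φ z := by
  set w := Complex.exp (Complex.I * z) with hw
  set μ := Complex.exp (-(Complex.I * z)) with hμ
  have hwμ : w * μ = 1 := by rw [hw, hμ, ← Complex.exp_add]; simp
  have hw1 : ‖w‖ < 1 := by
    rw [hw, Complex.norm_exp]
    simpa using hz
  set x : Γ.H := W.R z φ with hx
  have heq : ∀ a, W.evol x a - μ * x a = (φ : Γ.H) a := by
    have h1 : (W.U - μ • (1 : Γ.H →L[ℂ] Γ.H)) x = φ := by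
      rw [hx, R, ← mul_apply_eq_comp, Ring.mul_inverse_cancel _ (W.isUnit_sub_exp hz)]
      rfl
    intro a
    exact congrArg (fun y : Γ.H => y a) h1
  have hsolve : ∀ e y f : ℂ, e - μ * y = f → y = w * (e - f) := by
    intro e y f h
    rw [← h, sub_sub_cancel, ← mul_assoc, hwμ, one_mul]
  -- Membership of `x` in `ℓ²` makes it bounded, which selects the solution given by the series.
  have hflat : ∀ j k, x (Arc.flat j k) =
      -RapidSeq.tailSeries (fun k => (φ : Γ.H) (Arc.flat j k)) k w := by
    intro j
    refine (RapidDecay.flat φ.2 j).eq_neg_tailSeries (x := fun k => x (Arc.flat j k))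
      (fun k => lp.norm_apply_le_norm two_ne_zero x _) hw1 fun k => ?_
    refine hsolve _ _ _ ?_
    rw [← heq, evol_flat]
  have hflat0 : ∀ j, x (Arc.flat j 0) = -flatMap j φ z := by
    intro j
    rw [hflat]
    simp only [RapidSeq.tailSeries, zero_add]
    rfl
  have hsharp : ∀ j k, x (Arc.sharp j k) = w ^ (k + 1) * W.evol x (Arc.sharp j 0) -
      RapidSeq.convSeries (fun k => (φ : Γ.H) (Arc.sharp j k)) k w := by
    intro j
    refine RapidSeq.eq_sub_convSeries (x := fun k => x (Arc.sharp j k))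
      (hsolve _ _ _ (heq _)) fun k => hsolve _ _ _ ?_
    rw [← heq, evol_sharp_succ]
  have hint : ∀ a : Γ.IntArc, x a.arc = ∑ b, (W.pencil z)⁻¹ a b * W.source b φ z := by
    have h1 : (W.pencil z).mulVec (fun a => x a.arc) = fun a => W.source a φ z := by
      funext a
      have h2 := heq a.arc
      rw [evol_arc] at h2
      simp only [hflat0, mul_neg, Finset.sum_neg_distrib] at h2
      rw [pencil_mulVec]
      change _ = (φ : Γ.H) a.arc + ∑ j, W.amp a.arc (Arc.flat j 0) * flatMap j φ z
      rw [← h2]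
      ring
    have h3 : (W.pencil z)⁻¹.mulVec (fun a => W.source a φ z) = fun a => x a.arc := by
      rw [← h1, Matrix.mulVec_mulVec, Matrix.nonsing_inv_mul _ (W.det_pencil_ne_zero hz).isUnit,
        Matrix.one_mulVec]
    exact fun a => (congrFun h3 a).symm
  have hin : HasSum (fun a => starRingEnd ℂ ((φ : Γ.H) a) * x a) (W.F φ z) := by
    have := lp.hasSum_inner (𝕜 := ℂ) (φ : Γ.H) x
    simpa [RCLike.inner_apply, mul_comm, F] using this
  have hs : ∀ j, HasSum (fun k => starRingEnd ℂ ((φ : Γ.H) (Arc.flat j k)) * x (Arc.flat j k))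
      (-∑' k, starRingEnd ℂ ((φ : Γ.H) (Arc.flat j k)) *
        RapidSeq.tailSeries (fun k => (φ : Γ.H) (Arc.flat j k)) k w) := by
    intro j
    simp only [hflat, mul_neg]
    exact ((RapidDecay.flat φ.2 j).summable_tailSeries w).hasSum.neg
  have ht : ∀ j, HasSum (fun k => starRingEnd ℂ ((φ : Γ.H) (Arc.sharp j k)) * x (Arc.sharp j k))
      (sharpMap j φ z * W.evol x (Arc.sharp j 0) -
        ∑' k, starRingEnd ℂ ((φ : Γ.H) (Arc.sharp j k)) *
        RapidSeq.convSeries (fun k => (φ : Γ.H) (Arc.sharp j k)) k w) := by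
    intro j
    simp only [hsharp, mul_sub, ← mul_assoc]
    exact (((RapidDecay.sharp φ.2 j).conj.summable_mul_pow w).hasSum.mul_right _).sub
      ((RapidDecay.sharp φ.2 j).summable_convSeries w).hasSum
  rw [hin.unique (hasSum_arc hs ht), extF, regularPart]
  have hprobe : ∑ a : Γ.IntArc, ∑ b : Γ.IntArc,
      W.probe a φ z * (W.pencil z)⁻¹ a b * W.source b φ z =
      ∑ a : Γ.IntArc, starRingEnd ℂ ((φ : Γ.H) a.arc) * x a.arc +
        ∑ j, sharpMap j φ z * ∑ a : Γ.IntArc, W.amp (Arc.sharp j 0) a.arc * x a.arc := by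
    simp only [mul_assoc, ← Finset.mul_sum, ← hint]
    simp only [Finset.mul_sum]
    rw [Finset.sum_comm (s := Finset.univ (α := Fin N)), ← Finset.sum_add_distrib]
    refine Finset.sum_congr rfl fun a _ => ?_
    change (starRingEnd ℂ ((φ : Γ.H) a.arc) +
      ∑ j, W.amp (Arc.sharp j 0) a.arc * sharpMap j φ z) * _ = _
    rw [add_mul, Finset.sum_mul]
    congr 1
    exact Finset.sum_congr rfl fun j _ => by ring
  rw [hprobe]
  simp only [evol_sharp_zero, hflat0, mul_add, Finset.sum_sub_distrib, Finset.sum_add_distrib,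
    Finset.sum_neg_distrib, mul_neg, Finset.mul_sum, mul_assoc]
  ring

/-! ### Poles of the extension -/

theorem differentiable_det {ι : Type*} [Fintype ι] {A : ℂ → Matrix ι ι ℂ}
    (h : ∀ i j, Differentiable ℂ fun z => A z i j) : Differentiable ℂ fun z => (A z).det := by
  simp only [Matrix.det_apply']
  fun_prop

theorem differentiable_adjugate {ι : Type*} [Fintype ι] {A : ℂ → Matrix ι ι ℂ}
    (h : ∀ i j, Differentiable ℂ fun z => A z i j) (a b : ι) :
    Differentiable ℂ fun z => (A z).adjugate a b := by
  simp only [Matrix.adjugate_apply]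
  refine differentiable_det fun i j => ?_
  simp only [Matrix.updateRow_apply]
  split_ifs
  · exact differentiable_const _
  · exact h i j

theorem differentiable_pencil (a b : Γ.IntArc) : Differentiable ℂ fun z => W.pencil z a b := by
  simp only [pencil, Matrix.sub_apply, Matrix.smul_apply, smul_eq_mul]
  fun_prop

theorem pencil_inv_apply (z : ℂ) (a b : Γ.IntArc) :
    (W.pencil z)⁻¹ a b = ((W.pencil z).det)⁻¹ * (W.pencil z).adjugate a b := by
  simp [Matrix.inv_def, Ring.inverse_eq_inv']

/-- Otherwise the determinant would vanish identically, but it has no zero in the upper half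
plane. -/
theorem not_eventually_det_eq_zero (z₀ : ℂ) : ¬∀ᶠ z in 𝓝 z₀, (W.pencil z).det = 0 := by
  intro h
  have h1 := AnalyticOnNhd.eqOn_zero_of_preconnected_of_eventuallyEq_zero (U := Set.univ)
    (fun z _ => (differentiable_det W.differentiable_pencil).analyticAt z) isPreconnected_univ
    (Set.mem_univ z₀) h
  exact W.det_pencil_ne_zero (z := Complex.I) (by simp) (h1 (Set.mem_univ _))

/-- By Cramer's rule and the factorization of the determinant at a zero, the extension is a sum of
products of analytic families of functionals, divided by a power of `z - z₀`. -/
theorem hasFiniteRankPoleAt_extF (z₀ : ℂ) : HasFiniteRankPoleAt W.extF z₀ := by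
  obtain ⟨n, g, hg, hg0, hgn⟩ :=
    ((differentiable_det W.differentiable_pencil).analyticAt
      z₀).exists_eventuallyEq_pow_smul_nonzero_iff.2 (W.not_eventually_det_eq_zero z₀)
  let q : Γ.IntArc → Γ.IntArc → Γ.decaySpace →ₗ⋆[ℂ] ℂ → ℂ := fun a b =>
    (LinearMap.mulLeft ℂ (fun z => (g z)⁻¹ * (W.pencil z).adjugate a b)).comp (W.probe a)
  have hq : ∀ a b φ, AnalyticAt ℂ (q a b φ) z₀ := fun a b φ =>
    ((hg.inv hg0).mul ((differentiable_adjugate W.differentiable_pencil a b).analyticAt z₀)).mul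
      ((W.differentiable_probe a φ).analyticAt z₀)
  refine ((hasFiniteRankPoleAt_of_analyticAt
    fun φ => (W.differentiable_regularPart φ).analyticAt z₀).add
    (HasFiniteRankPoleAt.sum Finset.univ fun a _ => HasFiniteRankPoleAt.sum Finset.univ fun b _ =>
      hasFiniteRankPoleAt_mul z₀ n (q a b) (W.source b) (hq a b)
        fun φ => (W.differentiable_source b φ).analyticAt z₀)).congr fun φ => ?_
  filter_upwards [hgn.filter_mono nhdsWithin_le_nhds] with z hz
  rw [extF]
  congr 1
  refine Finset.sum_congr rfl fun a _ => Finset.sum_congr rfl fun b _ => ?_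
  change _ = ((z - z₀) ^ n)⁻¹ * (((g z)⁻¹ * (W.pencil z).adjugate a b) * W.probe a φ z *
    W.source b φ z)
  rw [pencil_inv_apply, hz, smul_eq_mul, mul_inv]
  ring

theorem not_isPole_extF {z₀ : ℂ} (h : (W.pencil z₀).det ≠ 0) (φ : Γ.decaySpace) :
    ¬IsPole (W.extF φ) z₀ := by
  have h1 : AnalyticAt ℂ (W.extF φ) z₀ := by
    have hd := ((differentiable_det W.differentiable_pencil).analyticAt z₀).inv h
    have ha := fun a b => (differentiable_adjugate W.differentiable_pencil a b).analyticAt z₀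
    have hr := (W.differentiable_regularPart φ).analyticAt z₀
    have hp := fun a => (W.differentiable_probe a φ).analyticAt z₀
    have hs := fun a => (W.differentiable_source a φ).analyticAt z₀
    unfold extF
    simp only [pencil_inv_apply]
    refine hr.fun_add (Finset.analyticAt_fun_sum _ fun a _ => Finset.analyticAt_fun_sum _ fun b _ =>
      ((hp a).fun_mul (hd.fun_mul (ha a b))).fun_mul (hs b))
  exact fun h2 => not_lt.2 h1.meromorphicOrderAt_nonneg h2.2

/-- For an internal state `φ` the tails do not contribute. -/
theorem extF_intExt (v : Γ.IntArc → ℂ) (z : ℂ) :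
    W.extF (intExt v) z = star v ⬝ᵥ (W.pencil z)⁻¹.mulVec v := by
  have h1 : ∀ j, flatMap j (intExt v) z = 0 := fun j => by simp [flatMap]
  have h2 : ∀ j, sharpMap j (intExt v) z = 0 := fun j => by simp [sharpMap]
  have h3 : ∀ a, W.source a (intExt v) z = v a := fun a => by simp [source, h1]
  have h4 : ∀ a, W.probe a (intExt v) z = star (v a) := fun a => by simp [probe, h2]
  simp only [extF, regularPart, h2, h3, h4]
  simp [dotProduct, Matrix.mulVec, Finset.mul_sum, mul_assoc]

open scoped ComplexOrder in
/-- An internal eigenvector `v` produces a pole, since then `⟨R(z) v, v⟩` equals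
`‖v‖² / (e^{-iz₀} - e^{-iz})`. -/
theorem exists_isPole_extF {z₀ : ℂ} (h : (W.pencil z₀).det = 0) :
    ∃ φ, IsPole (W.extF φ) z₀ := by
  obtain ⟨v, hv, hv'⟩ := Matrix.exists_mulVec_eq_zero_iff.2 h
  have hm := (W.hasFiniteRankPoleAt_extF z₀).meromorphicAt (intExt v)
  refine ⟨intExt v, hm, ?_⟩
  by_contra hn
  obtain ⟨c, hc⟩ := (tendsto_nhds_iff_meromorphicOrderAt_nonneg hm).2 (not_lt.1 hn)
  let d : ℂ → ℂ := fun z => Complex.exp (-(Complex.I * z₀)) - Complex.exp (-(Complex.I * z))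
  have hd : Tendsto d (𝓝[≠] z₀) (𝓝 0) := by
    have : Continuous d := by fun_prop
    simpa [d] using (this.tendsto z₀).mono_left nhdsWithin_le_nhds
  have hev : ∀ᶠ z in 𝓝[≠] z₀, (W.pencil z).det ≠ 0 :=
    ((differentiable_det W.differentiable_pencil).analyticAt
      z₀).eventually_eq_zero_or_eventually_ne_zero.resolve_left (W.not_eventually_det_eq_zero z₀)
  have hmul : ∀ᶠ z in 𝓝[≠] z₀, d z * W.extF (intExt v) z = star v ⬝ᵥ v := by
    filter_upwards [hev] with z hz
    have h1 : (W.pencil z).mulVec v = d z • v := by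
      funext a
      have h2 := congrFun hv' a
      rw [pencil_mulVec, Pi.zero_apply, sub_eq_zero] at h2
      rw [pencil_mulVec, h2]
      simp [d, sub_mul]
    have h3 : d z • (W.pencil z)⁻¹.mulVec v = v := by
      rw [← Matrix.mulVec_smul, ← h1, Matrix.mulVec_mulVec,
        Matrix.nonsing_inv_mul _ (isUnit_iff_ne_zero.2 hz), Matrix.one_mulVec]
    rw [extF_intExt, ← smul_eq_mul, ← dotProduct_smul, h3]
  have hlim := (tendsto_const_nhds.congr' (hmul.mono fun _ h => h.symm) :
    Tendsto (fun z => d z * W.extF (intExt v) z) (𝓝[≠] z₀) (𝓝 (star v ⬝ᵥ v)))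
  have h0 := tendsto_nhds_unique hlim (hd.mul hc)
  rw [zero_mul] at h0
  exact hv (dotProduct_star_self_eq_zero.1 h0)

theorem exists_isPole_extF_iff (z : ℂ) :
    (∃ φ, IsPole (W.extF φ) z) ↔ (W.pencil z).det = 0 :=
  ⟨fun ⟨φ, hφ⟩ => by_contra fun h => W.not_isPole_extF h φ hφ, W.exists_isPole_extF⟩

end QuantumWalk

end TailGraph

theorem mainTheorem7 {V : Type*} [Finite V] {N : ℕ} (hN : 0 < N) (Γ : TailGraph V N)
    (W : TailGraph.QuantumWalk Γ) :
    -- `𝒟` is a dense subset of `ℓ²(A)`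
    (∀ ψ : Γ.Arc → ℂ, TailGraph.RapidDecay ψ → Memℓp ψ 2) ∧
    Dense (Γ.decaySpace : Set Γ.H) ∧
    -- the resolvent `R(z)` exists for `Im z > 0`
    (∀ z : ℂ, 0 < z.im →
      IsUnit (W.U - Complex.exp (-(Complex.I * z)) • (1 : Γ.H →L[ℂ] Γ.H))) ∧
    -- meromorphic extension
    (∀ a : ℝ, a < 0 → ∃ G : Γ.decaySpace → ℂ → ℂ,
      (∀ φ, W.IsMeromorphicExtension a φ (G φ)) ∧
      -- the poles have finite rank
      (∀ z : ℂ, a < z.im → TailGraph.HasFiniteRankPoleAt G z) ∧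
      -- the poles lie on `𝕋` or in the strip between `a` and `0`
      (∀ φ, ∀ z : ℂ, a < z.im → TailGraph.IsPole (G φ) z → z.im = 0 ∨ (a < z.im ∧ z.im < 0)) ∧
      -- the poles are the eigenvalues of `U(θ)`, for every `θ`
      (∀ θ : ℂ, θ.im < 0 → ∀ z : ℂ, a < z.im → θ.im < z.im →
        ((∃ φ, TailGraph.IsPole (G φ) z) ↔
          W.IsDistortedEigenvalue θ (Complex.exp (-(Complex.I * z)))))) ∧
    -- the eigenvalues of `U(θ)` outside the disc of radius `e^{Im θ}` do not depend on `θ`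
    (∀ θ θ' : ℂ, θ.im < 0 → θ'.im < 0 → ∀ z : ℂ, θ.im < z.im → θ'.im < z.im →
      (W.IsDistortedEigenvalue θ (Complex.exp (-(Complex.I * z))) ↔
        W.IsDistortedEigenvalue θ' (Complex.exp (-(Complex.I * z))))) := by
  refine ⟨fun ψ h => h.memℓp, TailGraph.dense_decaySpace, fun z hz => W.isUnit_sub_exp hz,
    fun a _ => ⟨W.extF, fun φ => ⟨W.extF_periodic φ, fun z hz => W.extF_eq_F φ hz, fun z _ =>
      (W.hasFiniteRankPoleAt_extF z).meromorphicAt φ⟩, fun z _ => W.hasFiniteRankPoleAt_extF z,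
      fun φ z ha hp => ?_, fun θ _ z _ hz => ?_⟩, fun θ θ' _ _ z h h' => ?_⟩
  · rcases lt_trichotomy z.im 0 with h | h | h
    · exact Or.inr ⟨ha, h⟩
    · exact Or.inl h
    · exact (W.not_isPole_extF (W.det_pencil_ne_zero h) φ hp).elim
  · rw [W.exists_isPole_extF_iff, W.isDistortedEigenvalue_iff_det hz]
  · rw [W.isDistortedEigenvalue_iff_det h, W.isDistortedEigenvalue_iff_det h']
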